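/- **Setting.** Let $K$ be a field with a product formula and the Northcott property ("global field"), in the following sense. There are a family $M_K$ of real absolute values $|\cdot|_v$ on $K$ and positive real weights $n_v$ ($v\in M_K$) such that all but finitely many $|\cdot|_v$ are ultrametric, the non-ultrametric ones are induced by embeddings $K\hookrightarrow\mathbb C$, for every $x\in K^*$ one has $|x|_v=1$ for all but finitely many $v$, and $\prod_{v\in M_K}|x|_v^{n_v}=1$ for every $x\in K^*$. Let $\mathbb C_v$ be the completion of an algebraic closure of the completion $K_v$, with the unique extension of $|\cdot|_v$, let $\bar K$ be an algebraic closure of $K$, and fix a $K$-embedding $\bar K\hookrightarrow\mathbb C_v$ for every $v$. A subset of $\bar K$ is Galois-stable if it is stable under $\mathrm{Aut}(\bar K/K)$. The height of a nonempty finite Galois-stable set $S\subset\bar K$ is $h(S)=\frac1{\#S}\sum_{z\in S}\sum_{v}n_v\log^+|z|_v$, and $h(\alpha)$ is the height of the set of conjugates of $\alpha\in\bar K$. The Northcott property says that for all $D$ and $B$ only finitely many $\alpha\in\bar K$ satisfy $[K(\alpha):K]\le D$ and $h(\alpha)\le B$. Let $\phi\in K[z]$ have degree $d\ge2$. For a finite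 Galois-stable set $S$ put $$\hat h_\phi(S)=\lim_{m\to\infty}\frac1{d^m}\cdot\frac1{\#S}\sum_{z\in S}\sum_{v\in M_K}n_v\log^+|\phi^m(z)|_v ,$$ which is the average of the canonical heights of the points of $S$. For $v\in M_K$ put $\hat h_{\phi,v}(z)=\lim_{m\to\infty}d^{-m}\log^+|\phi^m(z)|_v$ for $z\in\mathbb C_v$, and let $F_v=\{z\in\mathbb C_v:|\phi^m(z)|_v\not\to\infty\}$ be the filled Julia set. The transfinite diameter of a bounded set $A\subset\mathbb C_v$ is $$c(A)=\lim_{n\to\infty}\ \sup_{x_1,\dots,x_n\in A}\ \prod_{i\ne j}|x_i-x_j|_v^{1/(n(n-1))}.$$ **Theorem.** Let $\{S_n\}$ be a sequence of pairwise distinct finite Galois-stable subsets of $\bar K$, all of whose elements are separable over $K$, such that $\lim_{n\to\infty}\hat h_\phi(S_n)=0$. Then for every $v\in M_K$ the sequence $\{S_n\}$ is pseudo-equidistributed with respect to $(F_v,\hat h_{\phi,v})$. That is: 1. it is $\hat h_{\phi,v}$-taut: $\displaystyle\lim_{n\to\infty}\frac1{\#S_n}\sum_{z\in S_n}\hat h_{\phi,v}(z)=0$;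 2. it is a generalized Fekete sequence for $F_v$: $N_n:=\#S_n\to\infty$, and $\displaystyle\prod_{x,y\in S_n,\,x\ne y}|x-y|_v^{1/(N_n(N_n-1))}$ converges to $c(F_v)$ as $n\to\infty$. -/

import Mathlib

open Filter Topology Polynomial

noncomputable section

/-! ### Dynamics and potential theory over a valued field -/

section LocalTheory

/-- The filled Julia set `{z : |φⁿ(z)| ↛ ∞}` of a polynomial over a valued field. -/
def filledJuliaSet {L : Type*} [NormedField L] (φ : L[X]) : Set L :=
  {z | ¬ Tendsto (fun n : ℕ => ‖(fun x => φ.eval x)^[n] z‖) atTop atTop}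

/-- The canonical local height `lim_n d⁻ⁿ log⁺ |φⁿ(z)|`, where `d = deg φ`. -/
def canonicalLocalHeight {L : Type*} [NormedField L] (φ : L[X]) (z : L) : ℝ :=
  limUnder atTop (fun n : ℕ =>
    Real.posLog ‖(fun x => φ.eval x)^[n] z‖ / (φ.natDegree : ℝ) ^ n)

/-- The `n`th diameter of `A`: the supremum over all `n`-tuples of points of `A` of the geometric
mean of the pairwise distances. (It is finite for bounded `A`, such as filled Julia sets.) -/
def nthDiameter {X : Type*} [MetricSpace X] (A : Set X) (n : ℕ) : ℝ :=
  ⨆ x : Fin n → A, ∏ p ∈ (Finset.univ : Finset (Fin n)).offDiag,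
    dist (x p.1 : X) (x p.2) ^ (1 / ((n : ℝ) * ((n : ℝ) - 1)))

/-- The transfinite diameter of a (bounded) set: the limit of its `n`th diameters. -/
def transfiniteDiameter {X : Type*} [MetricSpace X] (A : Set X) : ℝ :=
  limUnder atTop (nthDiameter A)

/-- A sequence of finite sets is `lam`-taut if the average of `lam` on it tends to `0`. -/
def IsTaut {L : Type*} (lam : L → ℝ) (S : ℕ → Finset L) : Prop :=
  Tendsto (fun n => (∑ z ∈ S n, lam z) / ((S n).card : ℝ)) atTop (𝓝 0)

open Classical in
/-- The geometric mean of the pairwise distances of the points of a finite set. -/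
def pairwiseMean {L : Type*} [NormedField L] (T : Finset L) : ℝ :=
  ∏ p ∈ T.offDiag, ‖p.1 - p.2‖ ^ (1 / ((T.card : ℝ) * ((T.card : ℝ) - 1)))

/-- Generalized Fekete sequences for `F`. -/
def IsGeneralizedFekete {L : Type*} [NormedField L] (F : Set L) (S : ℕ → Finset L) : Prop :=
  Tendsto (fun n => (S n).card) atTop atTop ∧
    Tendsto (fun n => pairwiseMean (S n)) atTop (𝓝 (transfiniteDiameter F))

/-- Pseudo-equidistribution with respect to the pair `(F, lam)`. -/
def IsPseudoEquidistributed {L : Type*} [NormedField L] (F : Set L) (lam : L → ℝ)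
    (S : ℕ → Finset L) : Prop :=
  IsTaut lam S ∧ IsGeneralizedFekete F S

end LocalTheory

/-! ### Fields with a product formula -/

/-- A product formula structure on `K`, with places indexed by `M`: absolute values `|·|_v` and
positive real weights `n_v`. -/
structure ProductFormulaField (K : Type*) [Field K] (M : Type*) where
  /-- the absolute value `|·|_v` -/
  abv : M → AbsoluteValue K ℝ
  /-- the weight `n_v` -/
  weight : M → ℝ
  weight_pos : ∀ v, 0 < weight v
  finite_archimedean : {v | ¬ IsNonarchimedean (abv v)}.Finite
  exists_embedding : ∀ v, ¬ IsNonarchimedean (abv v) → ∃ σ : K →+* ℂ, ∀ x, abv v x = ‖σ x‖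
  finite_ne_one : ∀ x : K, x ≠ 0 → {v | abv v x ≠ 1}.Finite
  product_formula : ∀ x : K, x ≠ 0 → ∏ᶠ v, abv v x ^ weight v = 1

namespace ProductFormulaField

variable {K : Type*} [Field K] {M : Type*} (P : ProductFormulaField K M)

/-- The completion `K_v`. -/
abbrev CompletionAt (v : M) := (P.abv v).Completion

/-- The absolute value of `K_v` extends to the algebraic closure of `K_v`. -/
theorem exists_closureAbv (v : M) :
    ∃ w : AbsoluteValue (AlgebraicClosure (P.CompletionAt v)) ℝ,
      ∀ x : P.CompletionAt v, w (algebraMap _ _ x) = ‖x‖ := by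
  by_cases hna : IsNonarchimedean (P.abv v)
  · have hu : IsUltrametricDist (P.CompletionAt v) := by
      refine IsUltrametricDist.isUltrametricDist_of_forall_norm_add_le_max_norm fun x y => ?_
      induction x, y using UniformSpace.Completion.induction_on₂ with
      | hp => exact isClosed_le (by fun_prop) (by fun_prop)
      | ih a b =>
        rw [← UniformSpace.Completion.coe_add]
        simp only [UniformSpace.Completion.norm_coe]
        exact hna _ _
    by_cases ht : ∃ x : P.CompletionAt v, 1 < ‖x‖
    · let : NontriviallyNormedField (P.CompletionAt v) :=
        { (inferInstance : NormedField (P.CompletionAt v)) with non_trivial := ht }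
      exact ⟨@NormedField.toAbsoluteValue _
        (spectralNorm.normedField (P.CompletionAt v) (AlgebraicClosure (P.CompletionAt v))),
        fun x => spectralNorm_extends x⟩
    · push Not at ht
      classical
      refine ⟨AbsoluteValue.trivial, fun x => ?_⟩
      by_cases hx : x = 0
      · simp [hx]
      · rw [AbsoluteValue.trivial_apply (by simpa using hx)]
        have h1 := ht x
        have h2 := ht x⁻¹
        rw [norm_inv] at h2
        exact le_antisymm ((inv_le_one₀ (norm_pos_iff.2 hx)).1 h2) h1
  · obtain ⟨σ, hσ⟩ := P.exists_embedding v hna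
    let f : WithAbs (P.abv v) →+* ℂ := σ.comp (WithAbs.equiv (P.abv v)).toRingHom
    have hf : Isometry f := AddMonoidHomClass.isometry_of_norm f fun x => (hσ _).symm
    let g : P.CompletionAt v →+* ℂ := UniformSpace.Completion.extensionHom f hf.continuous
    have hg : Isometry g := hf.completion_extension
    let : Algebra (P.CompletionAt v) ℂ := g.toAlgebra
    let h : AlgebraicClosure (P.CompletionAt v) →ₐ[P.CompletionAt v] ℂ := IsAlgClosed.lift
    refine ⟨(NormedField.toAbsoluteValue ℂ).comp (f := h.toRingHom) h.toRingHom.injective,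
      fun x => ?_⟩
    change ‖h (algebraMap _ _ x)‖ = ‖x‖
    rw [h.commutes]
    exact hg.norm_map_of_map_zero (map_zero g) x

/-- The (unique) extension of `|·|_v` to the algebraic closure of `K_v`. -/
def closureAbv (v : M) : AbsoluteValue (AlgebraicClosure (P.CompletionAt v)) ℝ :=
  (P.exists_closureAbv v).choose

theorem closureAbv_algebraMap (v : M) (x : P.CompletionAt v) :
    P.closureAbv v (algebraMap _ _ x) = ‖x‖ :=
  (P.exists_closureAbv v).choose_spec x

/-- The field `ℂ_v`: the completion of the algebraic closure of `K_v`. -/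
abbrev Cv (v : M) := (P.closureAbv v).Completion

/-- A choice of an embedding of `K̄` into `ℂ_v` over `K` for every place `v`. -/
abbrev Embeddings := ∀ v : M, AlgebraicClosure K →ₐ[K] P.Cv v

end ProductFormulaField

/-- The smallest Galois-stable subset of `K̄` containing `T`. -/
def galoisHull {K : Type*} [Field K] (T : Set (AlgebraicClosure K)) : Set (AlgebraicClosure K) :=
  {z | ∃ σ : AlgebraicClosure K ≃ₐ[K] AlgebraicClosure K, ∃ t ∈ T, σ t = z}

namespace ProductFormulaField

variable {K : Type*} [Field K] {M : Type*} (P : ProductFormulaField K M)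

/-- The sum `∑_v log⁺ ‖z‖_v = ∑_v n_v log⁺ |z|_v` of the local heights of `z`. -/
def localHeightSum (e : P.Embeddings) (z : AlgebraicClosure K) : ℝ :=
  ∑ᶠ v : M, P.weight v * Real.posLog ‖e v z‖

/-- The absolute logarithmic height of a finite set `T ⊆ K̄`: the average of the sum of the local
heights over the smallest Galois-stable set containing `T`. -/
def height (e : P.Embeddings) (T : Set (AlgebraicClosure K)) : ℝ :=
  (∑ᶠ z ∈ galoisHull T, P.localHeightSum e z) / ((galoisHull T).ncard : ℝ)

/-- The Northcott finiteness property: finitely many elements of `K̄` of bounded degree and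
height. -/
def Northcott (e : P.Embeddings) : Prop :=
  ∀ (D : ℕ) (B : ℝ),
    {α : AlgebraicClosure K | (minpoly K α).natDegree ≤ D ∧ P.height e {α} ≤ B}.Finite

/-- The canonical height of a finite set `T ⊆ K̄`: the limit of `d⁻ⁿ` times the height of `φⁿ(T)`.
Points of `φⁿ(T)` are counted with multiplicity, so that this is the average of the canonical
heights of the points of the smallest Galois-stable set containing `T`. -/
def canonicalHeight (e : P.Embeddings) (φ : K[X]) (T : Set (AlgebraicClosure K)) : ℝ :=
  limUnder atTop (fun n : ℕ =>
    (∑ᶠ z ∈ galoisHull T, P.localHeightSum e ((fun x => aeval x φ)^[n] z)) /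
      ((galoisHull T).ncard : ℝ) / (φ.natDegree : ℝ) ^ n)

/-- `φ` considered as a polynomial over `ℂ_v`. -/
abbrev polyAt (φ : K[X]) (v : M) : (P.Cv v)[X] := φ.map (algebraMap K (P.Cv v))

/-- The image of a finite subset of `K̄` in `ℂ_v`. -/
def imageAt (e : P.Embeddings) (v : M) (T : Finset (AlgebraicClosure K)) : Finset (P.Cv v) :=
  T.map ⟨e v, (e v).injective⟩

end ProductFormulaField

end

/-! ### The canonical local height -/

section LocalHeight

variable {C : Type*} [NormedField C] (φ : C[X])

/-! Write `λ_v` for the canonical local height, `a` for the leading coefficient of `φ`, and `c_v =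
|a|_v^{-1/(d-1)}`. An upper bound at each place is played against the product formula.

Local upper bound: the mean pairwise distance of `N` points of `ℂ_v` has logarithm at most `log c_v
+ O((log N + 1)/(N - 1))` plus twice the average of `λ_v`. For this, the Vandermonde determinant is
computed with monic polynomials `f_j` of degree `j` built from iterates of `φ`, for which `|f_j(x)|`
is at most `c_v^j exp(j λ_v(x))` up to a factor of size `exp O(log j + 1)`
(`exists_monic_norm_eval_le`, `exists_prod_offDiag_rpow_le`).

Product formula: the product of the differences of the points of a Galois-stable separable set lies
in `K^*`, so its weighted logarithms sum to zero. At a good place `log |x - y| ≤ λ_v(x) + λ_v(y)`;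
hence the bad places together contribute at least minus twice the canonical height
(`neg_two_mul_canonicalHeight_le`). The product formula for `a` gives `∑ n_v log c_v = 0`, so the
upper bounds at the other bad places force the matching lower bound at `v`. The error terms vanish
because the Northcott property gives `N → ∞` and nonnegativity of the local heights gives tautness.

Finally `c_v` is the transfinite diameter of `F_v`. The upper estimate is the Vandermonde bound with
`λ_v = 0`; for the lower one, points of `F_v` are added one at a time, each far on average from its
predecessors (`exists_mem_filledJuliaSet_le_prod`). -/

theorem norm_eval_le_mul_max_pow (p : C[X]) {k : ℕ} (hk : p.natDegree ≤ k) :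
    ∃ A : ℝ, 0 ≤ A ∧ ∀ x : C, ‖p.eval x‖ ≤ A * max 1 ‖x‖ ^ k := by
  refine ⟨∑ i ∈ Finset.range (p.natDegree + 1), ‖p.coeff i‖,
    Finset.sum_nonneg fun _ _ => norm_nonneg _, fun x => ?_⟩
  rw [eval_eq_sum_range, Finset.sum_mul]
  refine (norm_sum_le _ _).trans (Finset.sum_le_sum fun i hi => ?_)
  rw [norm_mul, norm_pow]
  refine mul_le_mul_of_nonneg_left ?_ (norm_nonneg _)
  calc ‖x‖ ^ i ≤ max 1 ‖x‖ ^ i := pow_le_pow_left₀ (norm_nonneg _) (le_max_right _ _) _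
    _ ≤ max 1 ‖x‖ ^ k :=
      pow_le_pow_right₀ (le_max_left _ _) ((Finset.mem_range_succ_iff.1 hi).trans hk)

/-- With `A` bounding the lower-order terms, the leading term is at least twice their size once `‖x‖
≥ 1` and `‖x‖ ≥ 2A/‖a‖`. For smaller `x` the left side is bounded by a constant. -/
theorem max_pow_le_mul_max_norm_eval (hφ : 1 ≤ φ.natDegree) :
    ∃ A : ℝ, 1 ≤ A ∧ ∀ x : C, max 1 ‖x‖ ^ φ.natDegree ≤ A * max 1 ‖φ.eval x‖ := by
  set d := φ.natDegree with hd
  have ha : 0 < ‖φ.leadingCoeff‖ := by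
    rw [norm_pos_iff, leadingCoeff_ne_zero]
    rintro rfl
    simp [hd] at hφ
  set a := ‖φ.leadingCoeff‖
  obtain ⟨A, hA, hAx⟩ := norm_eval_le_mul_max_pow φ.eraseLead (k := d - 1)
    (eraseLead_natDegree_le φ)
  have hR : (1 : ℝ) ≤ max 1 (2 * A / a) := le_max_left _ _
  refine ⟨max 1 (2 * A / a) ^ d + 2 / a, ?_, fun x => ?_⟩
  · have := one_le_pow₀ (n := d) hR
    have : 0 ≤ 2 / a := by positivity
    linarith
  have hy : (1 : ℝ) ≤ max 1 ‖φ.eval x‖ := le_max_left _ _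
  have hM : (1 : ℝ) ≤ max 1 ‖x‖ := le_max_left _ _
  rw [add_mul]
  rcases le_total (max 1 ‖x‖) (max 1 (2 * A / a)) with h | h
  · have h1 : max 1 ‖x‖ ^ d ≤ max 1 (2 * A / a) ^ d := pow_le_pow_left₀ (by linarith) h _
    have h2 : 0 ≤ 2 / a * max 1 ‖φ.eval x‖ := by positivity
    nlinarith [one_le_pow₀ (n := d) hR]
  · rcases le_total ‖x‖ 1 with hx | hx
    · rw [max_eq_left hx, one_pow]
      have h2 : 0 ≤ 2 / a * max 1 ‖φ.eval x‖ := by positivity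
      nlinarith [one_le_pow₀ (n := d) hR]
    · rw [max_eq_right hx] at h hM ⊢
      have h3 : 2 * A ≤ a * ‖x‖ := by
        have := (le_max_right _ _).trans h
        rwa [div_le_iff₀ ha, mul_comm ‖x‖] at this
      have h4 : a * ‖x‖ ^ d ≤ ‖φ.eval x‖ + A * ‖x‖ ^ (d - 1) := by
        have h5 := hAx x
        rw [max_eq_right hx] at h5
        have h6 : φ.leadingCoeff * x ^ d = φ.eval x - φ.eraseLead.eval x := by
          have h6 := congrArg (eval x) (eraseLead_add_C_mul_X_pow φ)
          simp only [eval_add, eval_mul, eval_C, eval_pow, eval_X] at h6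
          rw [← h6, hd]
          ring
        calc a * ‖x‖ ^ d = ‖φ.leadingCoeff * x ^ d‖ := by rw [norm_mul, norm_pow]
          _ ≤ _ := by rw [h6]; exact (norm_sub_le _ _).trans (by gcongr)
      have h7 : ‖x‖ ^ d = ‖x‖ ^ (d - 1) * ‖x‖ := by
        rw [← pow_succ, Nat.sub_add_cancel hφ]
      have h8 : 2 * (A * ‖x‖ ^ (d - 1)) ≤ a * ‖x‖ ^ d := by
        rw [h7]
        nlinarith [pow_nonneg (norm_nonneg x) (d - 1)]
      have h9 : ‖x‖ ^ d ≤ 2 / a * ‖φ.eval x‖ := by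
        rw [div_mul_eq_mul_div, le_div_iff₀ ha]
        linarith
      have h10 : 2 / a * ‖φ.eval x‖ ≤ 2 / a * max 1 ‖φ.eval x‖ := by
        gcongr
        exact le_max_right _ _
      have h11 : 0 ≤ max 1 (2 * A / a) ^ d * max 1 ‖φ.eval x‖ := by positivity
      linarith

theorem exists_abs_posLog_norm_eval_sub_le (hφ : 1 ≤ φ.natDegree) :
    ∃ B : ℝ, 0 ≤ B ∧ ∀ x : C,
      |Real.posLog ‖φ.eval x‖ - φ.natDegree * Real.posLog ‖x‖| ≤ B := by
  obtain ⟨A₁, h₁, hA₁⟩ := norm_eval_le_mul_max_pow φ le_rfl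
  obtain ⟨A₂, h₂, hA₂⟩ := max_pow_le_mul_max_norm_eval φ hφ
  have l₁ : 0 ≤ Real.log (1 + A₁) := Real.log_nonneg (by linarith)
  have l₂ : 0 ≤ Real.log A₂ := Real.log_nonneg h₂
  refine ⟨Real.log (1 + A₁) + Real.log A₂, by positivity, fun x => ?_⟩
  rw [Real.posLog_eq_log_max_one (norm_nonneg _), Real.posLog_eq_log_max_one (norm_nonneg _),
    ← Real.log_pow]
  have hM : 1 ≤ max 1 ‖x‖ ^ φ.natDegree := one_le_pow₀ (le_max_left _ _)
  have hy : 1 ≤ max 1 ‖φ.eval x‖ := le_max_left _ _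
  rw [abs_le]
  constructor
  · have := Real.log_le_log (by positivity) (hA₂ x)
    rw [Real.log_mul (by positivity) (by positivity)] at this
    linarith
  · have : max 1 ‖φ.eval x‖ ≤ (1 + A₁) * max 1 ‖x‖ ^ φ.natDegree :=
      max_le (by nlinarith) ((hA₁ x).trans (by nlinarith))
    have := Real.log_le_log (by positivity) this
    rw [Real.log_mul (by positivity) (by positivity)] at this
    linarith

/-- Consecutive terms differ by at most `B / d^(n+1)`, so the sequence is Cauchy and moves by at
most `B/(d-1) ≤ B` in total. -/
theorem exists_canonicalLocalHeight_bound (hφ : 2 ≤ φ.natDegree) :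
    ∃ B : ℝ, 0 ≤ B ∧ ∀ x : C,
      Tendsto (fun n : ℕ => Real.posLog ‖(fun y => φ.eval y)^[n] x‖ / (φ.natDegree : ℝ) ^ n)
        atTop (𝓝 (canonicalLocalHeight φ x)) ∧
      |Real.posLog ‖x‖ - canonicalLocalHeight φ x| ≤ B := by
  obtain ⟨B, hB, hx⟩ := exists_abs_posLog_norm_eval_sub_le φ (by lia)
  have hd : (2 : ℝ) ≤ φ.natDegree := by exact_mod_cast hφ
  set d : ℝ := (φ.natDegree : ℝ)
  refine ⟨B, hB, fun x => ?_⟩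
  have key : ∀ n : ℕ, dist (Real.posLog ‖(fun y => φ.eval y)^[n] x‖ / d ^ n)
      (Real.posLog ‖(fun y => φ.eval y)^[n + 1] x‖ / d ^ (n + 1)) ≤ (B / d) * (1 / d) ^ n := by
    intro n
    rw [dist_comm, Real.dist_eq, Function.iterate_succ_apply']
    set y := (fun y => φ.eval y)^[n] x
    have : Real.posLog ‖φ.eval y‖ / d ^ (n + 1) - Real.posLog ‖y‖ / d ^ n
        = (Real.posLog ‖φ.eval y‖ - d * Real.posLog ‖y‖) / d ^ (n + 1) := by
      field_simp
      ring
    rw [this, abs_div, abs_of_pos (show 0 < d ^ (n + 1) by positivity)]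
    calc _ ≤ B / d ^ (n + 1) := by gcongr; exact hx y
      _ = _ := by
        rw [one_div, inv_pow, pow_succ]
        field_simp
  have hr : 1 / d < 1 := by rw [div_lt_one (by linarith)]; linarith
  have ht := (cauchySeq_of_le_geometric _ _ hr key).tendsto_limUnder
  refine ⟨ht, ?_⟩
  have := dist_le_of_le_geometric_of_tendsto₀ _ _ hr key ht
  rw [Real.dist_eq] at this
  simp only [Function.iterate_zero, id_eq, pow_zero, div_one] at this
  refine this.trans ?_
  have : B / d / (1 - 1 / d) = B / (d - 1) := by
    have : d - 1 ≠ 0 := by linarith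
    field_simp
  rw [this, div_le_iff₀ (by linarith)]
  nlinarith

variable {φ}

theorem tendsto_canonicalLocalHeight (hφ : 2 ≤ φ.natDegree) (x : C) :
    Tendsto (fun n : ℕ => Real.posLog ‖(fun y => φ.eval y)^[n] x‖ / (φ.natDegree : ℝ) ^ n)
      atTop (𝓝 (canonicalLocalHeight φ x)) :=
  ((exists_canonicalLocalHeight_bound φ hφ).choose_spec.2 x).1

theorem canonicalLocalHeight_nonneg (hφ : 2 ≤ φ.natDegree) (x : C) :
    0 ≤ canonicalLocalHeight φ x :=
  ge_of_tendsto' (tendsto_canonicalLocalHeight hφ x) fun _ =>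
    div_nonneg Real.posLog_nonneg (by positivity)

theorem canonicalLocalHeight_iterate (hφ : 2 ≤ φ.natDegree) (x : C) (n : ℕ) :
    canonicalLocalHeight φ ((fun y => φ.eval y)^[n] x)
      = φ.natDegree ^ n * canonicalLocalHeight φ x := by
  have hd : (0 : ℝ) < φ.natDegree := by exact_mod_cast (by lia : 0 < φ.natDegree)
  refine tendsto_nhds_unique (tendsto_canonicalLocalHeight hφ _) ?_
  refine Tendsto.congr (fun m => ?_) (((tendsto_add_atTop_iff_nat n).2
    (tendsto_canonicalLocalHeight hφ x)).const_mul ((φ.natDegree : ℝ) ^ n))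
  rw [← Function.iterate_add_apply, pow_add]
  field_simp

theorem canonicalLocalHeight_eval (hφ : 2 ≤ φ.natDegree) (x : C) :
    canonicalLocalHeight φ (φ.eval x) = φ.natDegree * canonicalLocalHeight φ x := by
  simpa using canonicalLocalHeight_iterate hφ x 1

/-- A positive height is multiplied by `d` at each step, and `log⁺` of the norm stays within bounded
distance of it, so the orbit would escape. -/
theorem canonicalLocalHeight_eq_zero (hφ : 2 ≤ φ.natDegree) {x : C}
    (hx : x ∈ filledJuliaSet φ) : canonicalLocalHeight φ x = 0 := by
  by_contra hne
  refine hx ?_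
  obtain ⟨B, -, hB⟩ := exists_canonicalLocalHeight_bound φ hφ
  have hpos := lt_of_le_of_ne (canonicalLocalHeight_nonneg hφ x) (Ne.symm hne)
  have hd : (1 : ℝ) < φ.natDegree := by exact_mod_cast (by lia : 1 < φ.natDegree)
  have h1 : Tendsto (fun n : ℕ => (φ.natDegree : ℝ) ^ n * canonicalLocalHeight φ x + (-B))
      atTop atTop := tendsto_atTop_add_const_right _ _
    ((tendsto_pow_atTop_atTop_of_one_lt hd).atTop_mul_const hpos)
  have h2 : Tendsto (fun n : ℕ => Real.posLog ‖(fun y => φ.eval y)^[n] x‖) atTop atTop := by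
    refine tendsto_atTop_mono (fun n => ?_) h1
    have := (hB ((fun y => φ.eval y)^[n] x)).2
    rw [canonicalLocalHeight_iterate hφ, abs_le] at this
    linarith
  refine tendsto_atTop_mono (fun n => ?_) h2
  rw [Real.posLog_eq_log_max_one (norm_nonneg _)]
  have := Real.log_le_sub_one_of_pos
    (show 0 < max 1 ‖(fun y => φ.eval y)^[n] x‖ by positivity)
  rcases max_cases 1 ‖(fun y => φ.eval y)^[n] x‖ with h | h
  · rw [h.1]; simp
  · rw [h.1] at this ⊢; linarith

theorem norm_le_exp_canonicalLocalHeight (hφ : 2 ≤ φ.natDegree) :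
    ∃ R : ℝ, 1 ≤ R ∧ ∀ x : C, ‖x‖ ≤ R * Real.exp (canonicalLocalHeight φ x) := by
  obtain ⟨B, hB0, hB⟩ := exists_canonicalLocalHeight_bound φ hφ
  refine ⟨Real.exp B, Real.one_le_exp hB0, fun x => ?_⟩
  rw [← Real.exp_add]
  have h1 := (abs_le.1 (hB x).2).2
  have h2 : Real.log (max 1 ‖x‖) ≤ B + canonicalLocalHeight φ x := by
    rw [← Real.posLog_eq_log_max_one (norm_nonneg _)]; linarith
  exact (le_max_right 1 _).trans ((Real.log_le_iff_le_exp (by positivity)).1 h2)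

theorem eval_iterate_mem_filledJuliaSet (n : ℕ) {x : C} :
    (fun y => φ.eval y)^[n] x ∈ filledJuliaSet φ ↔ x ∈ filledJuliaSet φ := by
  simp only [filledJuliaSet, Set.mem_ofPred_eq, ← Function.iterate_add_apply]
  rw [tendsto_add_atTop_iff_nat (f := fun m => ‖(fun y => φ.eval y)^[m] x‖) n]

theorem mem_filledJuliaSet_of_isFixed_iterate {n : ℕ} (hn : n ≠ 0) {x : C}
    (hx : (fun y => φ.eval y)^[n] x = x) : x ∈ filledJuliaSet φ := by
  intro h
  have h1 : Tendsto (fun k : ℕ => k * n) atTop atTop :=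
    tendsto_id.atTop_mul_const' (Nat.pos_of_ne_zero hn)
  have h2 := h.comp h1
  have h3 : ((fun m : ℕ => ‖(fun y => φ.eval y)^[m] x‖) ∘ fun k : ℕ => k * n)
      = fun _ => ‖x‖ := by
    funext k
    have : ((fun y => φ.eval y)^[n])^[k] x = x := Function.iterate_fixed hx k
    rw [Function.comp_apply, mul_comm, Function.iterate_mul, this]
  rw [h3] at h2
  exact not_tendsto_const_atTop _ _ h2

end LocalHeight

/-! ### The Vandermonde estimate -/

section Vandermonde

variable {C : Type*} [NormedField C] {φ : C[X]}

/-- The quantity `|a|^{-1/(d-1)}` for a polynomial of degree `d` with leading coefficient `a`; it is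
the capacity of the filled Julia set. -/
noncomputable def dynamicalCapacity (φ : C[X]) : ℝ :=
  ‖φ.leadingCoeff‖ ^ (-(1 / ((φ.natDegree : ℝ) - 1)))

theorem dynamicalCapacity_pos (hφ : 2 ≤ φ.natDegree) : 0 < dynamicalCapacity φ := by
  refine Real.rpow_pos_of_pos (norm_pos_iff.2 (leadingCoeff_ne_zero.2 ?_)) _
  rintro rfl
  simp at hφ

theorem norm_leadingCoeff_mul_dynamicalCapacity_pow (hφ : 2 ≤ φ.natDegree) :
    ‖φ.leadingCoeff‖ * dynamicalCapacity φ ^ (φ.natDegree - 1) = 1 := by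
  have ha : 0 < ‖φ.leadingCoeff‖ := by
    refine norm_pos_iff.2 (leadingCoeff_ne_zero.2 ?_)
    rintro rfl
    simp at hφ
  have hd : (2 : ℝ) ≤ φ.natDegree := by exact_mod_cast hφ
  have hd' : (φ.natDegree : ℝ) - 1 ≠ 0 := by linarith
  rw [dynamicalCapacity, ← Real.rpow_natCast, ← Real.rpow_mul ha.le, Nat.cast_sub (by lia)]
  have : -(1 / ((φ.natDegree : ℝ) - 1)) * ((φ.natDegree : ℝ) - ((1 : ℕ) : ℝ)) = -1 := by
    push_cast
    field_simp
  rw [this, Real.rpow_neg_one, mul_inv_cancel₀ ha.ne']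

theorem log_dynamicalCapacity (φ : C[X]) :
    Real.log (dynamicalCapacity φ)
      = -(1 / ((φ.natDegree : ℝ) - 1)) * Real.log ‖φ.leadingCoeff‖ := by
  rcases eq_or_ne φ 0 with rfl | h
  · simp [dynamicalCapacity]
  · rw [dynamicalCapacity, Real.log_rpow (norm_pos_iff.2 (leadingCoeff_ne_zero.2 h))]

/-- Expand `j` in base `d`: for `j = dq + r` take `f_j = a^{-q} X^r (f_q ∘ φ)`. Since `λ(φ(x)) = d
λ(x)` and `|a|⁻¹ = c^(d-1)`, the exponents of `c` and of `exp λ` come out exactly `j`. Each digit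
costs a factor `Q^r ≤ Q^d`, and there are only about `log_d j + 1` digits. -/
theorem exists_monic_norm_eval_le (hφ : 2 ≤ φ.natDegree) :
    ∃ Q : ℝ, 1 ≤ Q ∧ ∀ j : ℕ, ∃ f : C[X], f.Monic ∧ f.natDegree = j ∧ ∀ x : C,
      ‖f.eval x‖ ≤ dynamicalCapacity φ ^ j * Q ^ (φ.natDegree * (Nat.log φ.natDegree j + 1)) *
        Real.exp (j * canonicalLocalHeight φ x) := by
  obtain ⟨R, hR1, hR⟩ := norm_le_exp_canonicalLocalHeight hφ
  have hc := dynamicalCapacity_pos hφ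
  have hac := norm_leadingCoeff_mul_dynamicalCapacity_pow hφ
  set c := dynamicalCapacity φ
  have hd0 : φ.leadingCoeff ≠ 0 := by
    rw [leadingCoeff_ne_zero]
    rintro rfl
    simp at hφ
  -- `Q` is chosen so that `‖x‖ ≤ R exp λ(x) ≤ c Q exp λ(x)`, which pays for one factor `X`.
  have hQ : (1 : ℝ) ≤ max 1 (R / c) := le_max_left _ _
  have hRQ : R ≤ c * max 1 (R / c) := by
    rw [← div_le_iff₀' hc]
    exact le_max_right _ _
  set Q := max 1 (R / c)
  have hpow : ∀ (r : ℕ) (x : C),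
      ‖x‖ ^ r ≤ c ^ r * Q ^ r * Real.exp (r * canonicalLocalHeight φ x) := by
    intro r x
    rw [Real.exp_nat_mul, ← mul_pow, ← mul_pow]
    exact pow_le_pow_left₀ (norm_nonneg _)
      ((hR x).trans (mul_le_mul_of_nonneg_right hRQ (Real.exp_nonneg _))) _
  refine ⟨Q, hQ, fun j => ?_⟩
  induction j using Nat.strong_induction_on with
  | _ j ih =>
  rcases lt_or_ge j φ.natDegree with hj | hj
  · refine ⟨X ^ j, monic_X_pow j, natDegree_X_pow j, fun x => ?_⟩
    rw [eval_pow, eval_X, norm_pow]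
    refine (hpow j x).trans ?_
    gcongr
    · exact hj.le.trans (Nat.le_mul_of_pos_right _ (Nat.succ_pos _))
  · set d := φ.natDegree
    obtain ⟨f, hf1, hf2, hf3⟩ := ih (j / d) (Nat.div_lt_self (by lia) (by lia))
    set q := j / d
    have hjq : d * q + j % d = j := Nat.div_add_mod j d
    set r := j % d
    have hr : r < d := Nat.mod_lt _ (by lia)
    have hcomp : f.comp φ ≠ 0 := by
      rw [← leadingCoeff_ne_zero, leadingCoeff_comp (by lia), hf1.leadingCoeff, one_mul]
      exact pow_ne_zero _ hd0
    have hu : φ.leadingCoeff⁻¹ ^ q ≠ 0 := pow_ne_zero _ (inv_ne_zero hd0)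
    refine ⟨Polynomial.C (φ.leadingCoeff⁻¹ ^ q) * (X ^ r * f.comp φ), ?_, ?_, fun x => ?_⟩
    · rw [Monic, leadingCoeff_mul, leadingCoeff_C, leadingCoeff_mul, leadingCoeff_X_pow,
        leadingCoeff_comp (by lia), hf1.leadingCoeff, hf2, one_mul, one_mul, ← mul_pow,
        inv_mul_cancel₀ hd0, one_pow]
    · rw [natDegree_C_mul hu, natDegree_mul (pow_ne_zero _ X_ne_zero) hcomp, natDegree_X_pow,
        natDegree_comp, hf2]
      lia
    · have h1 : ‖φ.leadingCoeff‖⁻¹ = c ^ (d - 1) := inv_eq_of_mul_eq_one_right hac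
      rw [eval_mul, eval_C, eval_mul, eval_pow, eval_X, eval_comp, norm_mul, norm_mul, norm_pow,
        norm_inv, h1, norm_pow]
      have h2 := hf3 (φ.eval x)
      rw [canonicalLocalHeight_eval hφ] at h2
      have hlog : Nat.log d j = Nat.log d q + 1 := by
        have := Nat.log_div_base d j
        have := Nat.log_pos (b := d) (by lia) hj
        lia
      calc (c ^ (d - 1)) ^ q * (‖x‖ ^ r * ‖f.eval (φ.eval x)‖)
          ≤ (c ^ (d - 1)) ^ q * ((c ^ r * Q ^ r * Real.exp (r * canonicalLocalHeight φ x)) *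
            (c ^ q * Q ^ (d * (Nat.log d q + 1)) *
              Real.exp (q * (d * canonicalLocalHeight φ x)))) := by
            gcongr
            exact hpow r x
        _ = c ^ ((d - 1) * q + r + q) * Q ^ (r + d * (Nat.log d q + 1)) *
            Real.exp (((d * q + r : ℕ) : ℝ) * canonicalLocalHeight φ x) := by
            push_cast
            rw [add_mul (_ * _), Real.exp_add, pow_add, pow_add, pow_add, pow_mul]
            ring_nf
        _ ≤ c ^ j * Q ^ (d * (Nat.log d j + 1)) *
            Real.exp (j * canonicalLocalHeight φ x) := by
            have e1 : (d - 1) * q + r + q = j := by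
              obtain ⟨d', hd'⟩ : ∃ d', d = d' + 1 := ⟨d - 1, by lia⟩
              rw [hd'] at hjq ⊢
              rw [Nat.add_sub_cancel, ← hjq]
              ring
            rw [e1, hjq, hlog]
            gcongr
            rw [mul_add d (Nat.log d q + 1)]
            lia

theorem prod_offDiag_norm_sub_eq {n : ℕ} (x : Fin n → C) :
    ∏ p ∈ (Finset.univ : Finset (Fin n)).offDiag, ‖x p.1 - x p.2‖
      = ‖(Matrix.vandermonde x).det‖ ^ 2 := by
  rw [Matrix.det_vandermonde, norm_prod, sq]
  simp_rw [norm_prod]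
  have h1 : ∏ i, ∏ j ∈ Finset.Ioi i, ‖x j - x i‖
      = ∏ p ∈ (Finset.univ : Finset (Fin n × Fin n)) with p.1 < p.2, ‖x p.1 - x p.2‖ := by
    rw [Finset.prod_filter, ← Finset.univ_product_univ, Finset.prod_product]
    refine Finset.prod_congr rfl fun i _ => ?_
    rw [← Finset.prod_filter]
    refine Finset.prod_congr (by ext; simp) fun j _ => norm_sub_rev _ _
  have h2 : ∏ i, ∏ j ∈ Finset.Ioi i, ‖x j - x i‖
      = ∏ p ∈ (Finset.univ : Finset (Fin n × Fin n)) with p.2 < p.1, ‖x p.1 - x p.2‖ := by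
    rw [Finset.prod_filter, ← Finset.univ_product_univ, Finset.prod_product_right]
    refine Finset.prod_congr rfl fun i _ => ?_
    rw [← Finset.prod_filter]
    refine Finset.prod_congr (by ext; simp) fun j _ => rfl
  conv_rhs => rw [h2]
  nth_rewrite 1 [← h2]
  rw [h1, ← Finset.prod_union]
  · refine Finset.prod_congr ?_ fun _ _ => rfl
    ext p
    simp [Finset.mem_offDiag, ← lt_or_lt_iff_ne]
  · rw [Finset.disjoint_filter]
    exact fun p _ h => not_lt.2 h.le

/-- Replacing the monomials by the monic `f_j` does not change the determinant; each of the `n!`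
terms of the Leibniz expansion is then bounded by the estimate for the `f_j`. -/
theorem exists_norm_det_vandermonde_le (hφ : 2 ≤ φ.natDegree) :
    ∃ Q : ℝ, 1 ≤ Q ∧ ∀ (n : ℕ) (x : Fin n → C),
      ‖(Matrix.vandermonde x).det‖ ≤ n.factorial *
        (dynamicalCapacity φ ^ (∑ i : Fin n, (i : ℕ)) *
          (Q ^ (φ.natDegree * (Nat.log φ.natDegree n + 1))) ^ n *
          Real.exp (((n : ℝ) - 1) * ∑ i, canonicalLocalHeight φ (x i))) := by
  obtain ⟨Q, hQ1, hQ⟩ := exists_monic_norm_eval_le hφ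
  choose f hf1 hf2 hf3 using hQ
  refine ⟨Q, hQ1, fun n x => ?_⟩
  have hc := dynamicalCapacity_pos hφ
  rw [Matrix.det_eval_matrixOfPolynomials_eq_det_vandermonde x (fun i => f i)
    (fun i => hf2 i) (fun i => hf1 i), Matrix.det_apply]
  refine (norm_sum_le _ _).trans ?_
  have hcard : (n.factorial : ℝ) = ((Finset.univ : Finset (Equiv.Perm (Fin n))).card : ℝ) := by
    rw [Finset.card_univ, Fintype.card_perm, Fintype.card_fin]
  rw [hcard, ← nsmul_eq_mul]
  refine Finset.sum_le_card_nsmul _ _ _ fun σ _ => ?_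
  have hs : ‖Equiv.Perm.sign σ • ∏ i, (Matrix.of fun i j : Fin n => eval (x i) (f j)) (σ i) i‖
      = ∏ i, ‖eval (x (σ i)) (f i)‖ := by
    rcases Int.units_eq_one_or (Equiv.Perm.sign σ) with h | h <;> simp [h, norm_prod]
  rw [hs]
  calc ∏ i : Fin n, ‖eval (x (σ i)) (f i)‖
      ≤ ∏ i : Fin n, (dynamicalCapacity φ ^ (i : ℕ) *
        Q ^ (φ.natDegree * (Nat.log φ.natDegree n + 1)) *
        Real.exp (((n : ℝ) - 1) * canonicalLocalHeight φ (x (σ i)))) := by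
        refine Finset.prod_le_prod (fun _ _ => norm_nonneg _) fun i _ => (hf3 i _).trans ?_
        -- Bounding the degree uniformly by `n - 1` makes the height term independent of the
        -- permutation.
        have hi : ((i : ℕ) : ℝ) ≤ (n : ℝ) - 1 := by
          have : ((i : ℕ) : ℝ) + 1 ≤ n := by exact_mod_cast i.2
          linarith
        gcongr
        · exact i.2.le
        · exact canonicalLocalHeight_nonneg hφ _
    _ = _ := by
        rw [Finset.prod_mul_distrib, Finset.prod_mul_distrib, Finset.prod_pow_eq_pow_sum,
          Finset.prod_const, ← Real.exp_sum, ← Finset.mul_sum,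
          Equiv.sum_comp σ (fun i => canonicalLocalHeight φ (x i)), Finset.card_univ,
          Fintype.card_fin]

theorem exists_prod_offDiag_rpow_le (hφ : 2 ≤ φ.natDegree) :
    ∃ A : ℝ, 0 ≤ A ∧ ∀ (n : ℕ), 2 ≤ n → ∀ x : Fin n → C,
      ∏ p ∈ (Finset.univ : Finset (Fin n)).offDiag,
        ‖x p.1 - x p.2‖ ^ (1 / ((n : ℝ) * ((n : ℝ) - 1)))
      ≤ dynamicalCapacity φ * Real.exp (A * ((Real.log n + 1) / ((n : ℝ) - 1)) +
          2 * ((∑ i, canonicalLocalHeight φ (x i)) / n)) := by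
  obtain ⟨Q, hQ1, hQ⟩ := exists_norm_det_vandermonde_le hφ
  have hlQ := Real.log_nonneg hQ1
  have hc := dynamicalCapacity_pos hφ
  -- Squaring the determinant doubles the exponents `n log n` (from `n!`) and `n d (2 log n + 1) log
  -- Q`; both doubled terms are covered by `n A (log n + 1)`.
  refine ⟨2 + 4 * φ.natDegree * Real.log Q, by positivity, fun n hn x => ?_⟩
  have hn' : (2 : ℝ) ≤ n := by exact_mod_cast hn
  have hn1 : 0 < (n : ℝ) - 1 := by linarith
  rw [Real.finsetProd_rpow _ _ fun _ _ => norm_nonneg _, prod_offDiag_norm_sub_eq,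
    one_div, Real.rpow_inv_le_iff_of_pos (by positivity) (by positivity) (by positivity)]
  set Λ := ∑ i, canonicalLocalHeight φ (x i)
  have h1 : (n.factorial : ℝ) ≤ Real.exp (n * Real.log n) := by
    rw [mul_comm, Real.exp_mul, Real.exp_log (by linarith), Real.rpow_natCast]
    exact_mod_cast Nat.factorial_le_pow n
  -- The factor `2` works because `log d ≥ log 2 > 1/2`.
  have h2 : (Nat.log φ.natDegree n : ℝ) ≤ 2 * Real.log n := by
    have a1 : (φ.natDegree : ℝ) ^ Nat.log φ.natDegree n ≤ n := by
      exact_mod_cast Nat.pow_log_le_self _ (by lia)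
    have a2 := Real.log_le_log (by positivity) a1
    rw [Real.log_pow] at a2
    have a3 : Real.log 2 ≤ Real.log φ.natDegree :=
      Real.log_le_log (by norm_num) (by exact_mod_cast hφ)
    have a4 := Real.log_two_gt_d9
    have a5 : (0 : ℝ) ≤ Nat.log φ.natDegree n := Nat.cast_nonneg _
    nlinarith
  have h3 : (Q ^ (φ.natDegree * (Nat.log φ.natDegree n + 1))) ^ n
      ≤ Real.exp (n * (φ.natDegree * (2 * Real.log n + 1) * Real.log Q)) := by
    rw [Real.exp_nat_mul]
    refine pow_le_pow_left₀ (by positivity) ?_ _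
    rw [← Real.exp_log (show 0 < Q by linarith), ← Real.exp_nat_mul, Real.log_exp]
    refine Real.exp_le_exp.2 ?_
    push_cast
    gcongr
  have h4 : (∑ i : Fin n, (i : ℕ)) * 2 = n * (n - 1) := by
    rw [Fin.sum_univ_eq_sum_range (fun i => i) n, Finset.sum_range_id_mul_two]
  have h5 : ((n * (n - 1) : ℕ) : ℝ) = n * ((n : ℝ) - 1) := by
    rw [Nat.cast_mul, Nat.cast_sub (by lia), Nat.cast_one]
  have hlog : 0 ≤ Real.log n := Real.log_nonneg (by linarith)
  calc ‖(Matrix.vandermonde x).det‖ ^ 2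
      ≤ (Real.exp (n * Real.log n) * (dynamicalCapacity φ ^ (∑ i : Fin n, (i : ℕ)) *
        Real.exp (n * (φ.natDegree * (2 * Real.log n + 1) * Real.log Q)) *
          Real.exp (((n : ℝ) - 1) * Λ))) ^ 2 := by
        refine pow_le_pow_left₀ (norm_nonneg _) ((hQ n x).trans ?_) _
        gcongr
    _ = dynamicalCapacity φ ^ (n * (n - 1)) * Real.exp (2 * (n * Real.log n +
        n * (φ.natDegree * (2 * Real.log n + 1) * Real.log Q) + ((n : ℝ) - 1) * Λ)) := by
        rw [mul_pow, mul_pow, mul_pow, ← pow_mul, h4, ← Real.exp_nat_mul, ← Real.exp_nat_mul,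
          ← Real.exp_nat_mul, mul_add (2 : ℝ) (_ + _), mul_add (2 : ℝ) (n * Real.log n), Real.exp_add, Real.exp_add]
        push_cast
        ring
    _ ≤ dynamicalCapacity φ ^ (n * (n - 1)) * Real.exp ((n * ((n : ℝ) - 1)) *
        ((2 + 4 * φ.natDegree * Real.log Q) * ((Real.log n + 1) / ((n : ℝ) - 1)) +
          2 * (Λ / n))) := by
        refine mul_le_mul_of_nonneg_left (Real.exp_le_exp.2 ?_) (by positivity)
        have e : (n * ((n : ℝ) - 1)) *
            ((2 + 4 * φ.natDegree * Real.log Q) * ((Real.log n + 1) / ((n : ℝ) - 1)) +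
              2 * (Λ / n)) = n * ((2 + 4 * φ.natDegree * Real.log Q) * (Real.log n + 1)) +
              2 * (((n : ℝ) - 1) * Λ) := by
          field_simp
        rw [e]
        have : 0 ≤ n * (φ.natDegree * Real.log Q) := by positivity
        nlinarith
    _ = _ := by
        rw [← h5, Real.mul_rpow hc.le (Real.exp_nonneg _), Real.rpow_natCast,
          ← Real.exp_mul, mul_comm ((n * (n - 1) : ℕ) : ℝ)]

end Vandermonde

/-! ### The transfinite diameter of the filled Julia set -/

section BackwardOrbits

variable {L : Type*} [Field L] [IsAlgClosed L] {φ : L[X]}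

theorem exists_iterate_eval_eq (hφ : φ.natDegree ≠ 0) (m : ℕ) (w : L) :
    ∃ z, (fun y => φ.eval y)^[m] z = w := by
  induction m generalizing w with
  | zero => exact ⟨w, rfl⟩
  | succ m ih =>
    obtain ⟨y, hy⟩ := IsAlgClosed.exists_root (φ - C w) (by
      rw [degree_eq_natDegree (by
        intro h
        rw [sub_eq_zero.1 h] at hφ
        simp at hφ), natDegree_sub_C]
      exact_mod_cast hφ)
    obtain ⟨z, rfl⟩ := ih y
    refine ⟨z, ?_⟩
    rw [Function.iterate_succ_apply']
    simpa [sub_eq_zero] using hy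

/-- If `φ^m` is the identity on a finite set that is stable under taking preimages and contains the
fixed points of `φ^m`, then this set has `(deg φ)^m` elements. -/
theorem card_eq_pow_of_iterate_eq (hφ : 2 ≤ φ.natDegree) {E : Finset L} {m : ℕ} (hm : m ≠ 0)
    (hback : ∀ z, (fun y => φ.eval y)^[m] z ∈ E → z ∈ E)
    (hper : ∀ z, (fun y => φ.eval y)^[m] z = z → z ∈ E)
    (hid : ∀ z ∈ E, (fun y => φ.eval y)^[m] z = z) : E.card = φ.natDegree ^ m := by
  classical
  set Φ : L[X] := φ.comp^[m] X with hΦ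
  have hdeg : Φ.natDegree = φ.natDegree ^ m := by
    rw [hΦ, natDegree_iterate_comp, natDegree_X, mul_one]
  have hev : ∀ z, Φ.eval z = (fun y => φ.eval y)^[m] z := fun z => by
    rw [hΦ, iterate_comp_eval, eval_X]
  have hD : 2 ≤ Φ.natDegree := hdeg ▸ hφ.trans (Nat.le_self_pow hm _)
  have hGdeg : (Φ - X).natDegree = Φ.natDegree :=
    natDegree_sub_eq_left_of_natDegree_lt (by rw [natDegree_X]; lia)
  have hG0 : Φ - X ≠ 0 := by
    intro h
    rw [h, natDegree_zero] at hGdeg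
    lia
  have hroots : (Φ - X).roots.toFinset = E := by
    ext z
    rw [Multiset.mem_toFinset, mem_roots hG0, IsRoot, eval_sub, eval_X, sub_eq_zero, hev]
    exact ⟨hper z, hid z⟩
  -- A preimage of `w` lies in `E`, where `Φ` is the identity, so it is `w` itself. Thus `w` is the
  -- only root of `Φ - w`, a multiple one, and `Φ'(w) = 0`.
  have hder : ∀ w ∈ E, (derivative Φ).IsRoot w := by
    intro w hw
    have hd' : (Φ - C w).natDegree = Φ.natDegree := natDegree_sub_C
    have h0 : Φ - C w ≠ 0 := by
      intro h
      rw [h, natDegree_zero] at hd'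
      lia
    have hrep : (Φ - C w).roots = Multiset.replicate Φ.natDegree w := by
      rw [Multiset.eq_replicate, ← hd', ← (IsAlgClosed.splits _).natDegree_eq_card_roots]
      refine ⟨rfl, fun z hz => ?_⟩
      rw [mem_roots h0, IsRoot, eval_sub, eval_C, sub_eq_zero, hev] at hz
      rw [← hid z (hback z (hz ▸ hw)), hz]
    have hmult : 1 < (Φ - C w).rootMultiplicity w := by
      rw [← count_roots, hrep, Multiset.count_replicate_self]
      lia
    have := ((one_lt_rootMultiplicity_iff_isRoot h0).1 hmult).2
    rwa [derivative_sub, derivative_C, sub_zero] at this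
  -- At a root the derivative of `Φ - X` is `0 - 1`, so all roots are simple, in every
  -- characteristic.
  have hnodup : (Φ - X).roots.Nodup := by
    rw [Multiset.nodup_iff_count_le_one]
    intro w
    rw [count_roots]
    by_contra! h
    have h2 := (one_lt_rootMultiplicity_iff_isRoot hG0).1 h
    have hw : w ∈ E := by
      rw [← hroots, Multiset.mem_toFinset, mem_roots hG0]
      exact h2.1
    have h3 := h2.2
    rw [IsRoot, derivative_sub, derivative_X, eval_sub, (hder w hw).eq_zero, eval_one] at h3
    norm_num at h3
  rw [← hroots, Multiset.toFinset_card_of_nodup hnodup,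
    ← (IsAlgClosed.splits _).natDegree_eq_card_roots, hGdeg, hdeg]

/-- A completely invariant set that contains all periodic points is infinite. -/
theorem infinite_of_iterate_mem_iff (hφ : 2 ≤ φ.natDegree) {E : Set L}
    (hinv : ∀ z, φ.eval z ∈ E ↔ z ∈ E)
    (hper : ∀ m, m ≠ 0 → ∀ z, (fun y => φ.eval y)^[m] z = z → z ∈ E) : E.Infinite := by
  intro hfin
  have hinv' : ∀ (m : ℕ) z, (fun y => φ.eval y)^[m] z ∈ E ↔ z ∈ E := by
    intro m
    induction m with
    | zero => exact fun z => Iff.rfl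
    | succ m ih =>
      intro z
      rw [Function.iterate_succ_apply, ih, hinv]
  have : Finite E := hfin
  let g : E → E := fun z => ⟨φ.eval z.1, (hinv _).2 z.2⟩
  -- If `E` is finite, backward invariance makes `φ` surjective on it, hence a permutation of finite
  -- order.
  have hg : Function.Surjective g := by
    rintro ⟨w, hw⟩
    obtain ⟨z, hz⟩ := exists_iterate_eval_eq (φ := φ) (by lia) 1 w
    exact ⟨⟨z, (hinv' 1 z).1 (hz ▸ hw)⟩, Subtype.ext hz⟩
  let σ : Equiv.Perm E :=
    Equiv.ofBijective g (Finite.injective_iff_surjective.2 hg |>.bijective_of_finite)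
  have hσ : ∀ (m : ℕ) (z : E), (fun y => φ.eval y)^[m] z.1 = ((σ ^ m) z).1 := by
    intro m
    induction m with
    | zero => exact fun z => rfl
    | succ m ih =>
      intro z
      rw [Function.iterate_succ_apply, pow_succ, Equiv.Perm.mul_apply, ← ih]
      rfl
  have hord : orderOf σ ≠ 0 := (orderOf_pos σ).ne'
  -- Every multiple of the order gives an iterate that is the identity on `E`, so `E` would have
  -- both `d^o` and `d^(2o)` elements.
  have key : ∀ k, k ≠ 0 → hfin.toFinset.card = φ.natDegree ^ (orderOf σ * k) := by
    intro k hk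
    refine card_eq_pow_of_iterate_eq hφ (mul_ne_zero hord hk) ?_ ?_ ?_
    · intro z
      rw [hfin.mem_toFinset, hfin.mem_toFinset]
      exact (hinv' _ z).1
    · intro z hz
      rw [hfin.mem_toFinset]
      exact hper _ (mul_ne_zero hord hk) z hz
    · intro z hz
      rw [hfin.mem_toFinset] at hz
      rw [hσ _ ⟨z, hz⟩, pow_mul, pow_orderOf_eq_one, one_pow]
      rfl
  have h12 := (key 1 one_ne_zero).symm.trans (key 2 two_ne_zero)
  have := Nat.pow_right_injective hφ h12
  lia

end BackwardOrbits

/-! ### Capacity of the filled Julia set -/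

section TransfiniteDiameter

variable {C : Type*} [NormedField C]

theorem tendsto_log_add_one_div_sub_one :
    Tendsto (fun n : ℕ => (Real.log n + 1) / ((n : ℝ) - 1)) atTop (𝓝 0) := by
  have h1 : Tendsto (fun x : ℝ => Real.log x / x) atTop (𝓝 0) :=
    Real.isLittleO_log_id_atTop.tendsto_div_nhds_zero
  have h2 : Tendsto (fun x : ℝ => (Real.log x / x + x⁻¹) / (1 - x⁻¹)) atTop (𝓝 0) := by
    have := Tendsto.div (h1.add tendsto_inv_atTop_zero)
      ((tendsto_const_nhds (x := (1 : ℝ))).sub tendsto_inv_atTop_zero) (by norm_num)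
    rwa [add_zero, zero_div] at this
  refine (h2.comp tendsto_natCast_atTop_atTop).congr' ?_
  filter_upwards [eventually_ge_atTop 2] with n hn
  have hn' : (2 : ℝ) ≤ n := by exact_mod_cast hn
  have : (n : ℝ) - 1 ≠ 0 := by linarith
  have h0 : (n : ℝ) ≠ 0 := by linarith
  rw [Function.comp_apply]
  field_simp

theorem norm_leadingCoeff_iterate_comp_mul {φ : C[X]} (hφ : 2 ≤ φ.natDegree) (k : ℕ) :
    ‖(φ.comp^[k] X).leadingCoeff‖ * dynamicalCapacity φ ^ (φ.natDegree ^ k)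
      = dynamicalCapacity φ := by
  induction k with
  | zero => simp
  | succ k ih =>
    rw [Function.iterate_succ_apply', leadingCoeff_comp, norm_mul, norm_pow, pow_succ, pow_mul,
      mul_assoc, ← mul_pow, ih]
    · have := norm_leadingCoeff_mul_dynamicalCapacity_pow hφ
      rw [← Nat.sub_add_cancel (show 1 ≤ φ.natDegree by lia), pow_succ, ← mul_assoc,
        this, one_mul]
    · rw [natDegree_iterate_comp, natDegree_X, mul_one]
      exact pow_ne_zero _ (by lia)

theorem map_iterate_eval {L : Type*} [Field L] (i : L →+* C) {φ : L[X]} (m : ℕ) (z : L) :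
    i ((fun y => φ.eval y)^[m] z) = (fun y => (φ.map i).eval y)^[m] (i z) := by
  refine Function.Semiconj.iterate_right (f := i) (fun y => ?_) m z
  exact (eval_map_apply i y).symm

variable {L : Type*} [Field L] [IsAlgClosed L] (i : L →+* C) {φ : L[X]}

/-- Periodic points and preimages are found in the algebraically closed field `L`; nothing of the
kind is assumed of `C`. -/
theorem infinite_preimage_filledJuliaSet (hφ : 2 ≤ φ.natDegree) :
    (i ⁻¹' filledJuliaSet (φ.map i)).Infinite := by
  refine infinite_of_iterate_mem_iff hφ (fun z => ?_) fun m hm z hz => ?_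
  · have h1 := map_iterate_eval i (φ := φ) 1 z
    simp only [Function.iterate_one] at h1
    rw [Set.mem_preimage, Set.mem_preimage, h1]
    exact eval_iterate_mem_filledJuliaSet 1
  · refine mem_filledJuliaSet_of_isFixed_iterate hm ?_
    rw [← map_iterate_eval, hz]

/-- Among `n + 1` separated points, some point is far from all of `n` given points. -/
theorem exists_forall_le_norm_sub {S : Set C} (hS : S.Infinite) (n : ℕ) :
    ∃ δ : ℝ, 0 < δ ∧ ∀ y : Fin n → C, ∃ w ∈ S, ∀ j, δ ≤ ‖y j - w‖ := by
  classical
  obtain ⟨W, hWS, hW⟩ := hS.exists_subset_card_eq (n + 1)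
  obtain ⟨δ, hδ, hsep⟩ : ∃ δ : ℝ, 0 < δ ∧ ∀ p ∈ W.offDiag, 2 * δ ≤ ‖p.1 - p.2‖ := by
    rcases W.offDiag.eq_empty_or_nonempty with h | h
    · exact ⟨1, one_pos, by simp [h]⟩
    · obtain ⟨p, hp, hmin⟩ := Finset.exists_min_image W.offDiag (fun p => ‖p.1 - p.2‖) h
      have := norm_pos_iff.2 (sub_ne_zero.2 (Finset.mem_offDiag.1 hp).2.2)
      exact ⟨‖p.1 - p.2‖ / 2, by positivity, fun q hq => by
        rw [mul_div_cancel₀ _ two_ne_zero]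
        exact hmin q hq⟩
  refine ⟨δ, hδ, fun y => ?_⟩
  by_contra! hcon
  have hcon' : ∀ w : W, ∃ j, ‖y j - w‖ < δ := fun w => hcon w (hWS w.2)
  choose j hj using hcon'
  -- Pigeonhole: two of the `n + 1` points would be within `δ` of the same `y j`, although they are
  -- at least `2δ` apart.
  obtain ⟨w, w', hne, heq⟩ := Fintype.exists_ne_map_eq_of_card_lt j (by simp [hW])
  have h1 := hj w
  have h2 := hj w'
  rw [← heq] at h2
  have h3 := hsep (w, w') (Finset.mem_offDiag.2 ⟨w.2, w'.2, fun h => hne (Subtype.ext h)⟩)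
  have h4 : ‖(w : C) - w'‖ ≤ ‖y (j w) - w'‖ + ‖y (j w) - w‖ := by
    have : (w : C) - w' = (y (j w) - w') - (y (j w) - w) := by ring
    rw [this]
    exact norm_sub_le _ _
  simp only at h3
  linarith

/-- Suppose the product is below `b^n` on all of `F`. Apply this to all `d^k` preimages under `φ^k`
of a point `w` of `F`; they lie in `F`, and multiplying gives `∏ |φ^k(x_j) - w| ≤ (|a_k| b^(d^k))^n`
with `a_k` the leading coefficient of `φ^k`. As `|a_k| c^(d^k) = c`, the geometric mean over `j` is
at most `c (b/c)^(d^k)`, which tends to `0`. But `w` can be chosen at distance at least a fixed `δ`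
from every `φ^k(x_j)`. -/
theorem exists_mem_filledJuliaSet_le_prod (hφ : 2 ≤ φ.natDegree) {b : ℝ} (hb : 0 < b)
    (hbc : b < dynamicalCapacity (φ.map i)) {n : ℕ} (x : Fin n → C) :
    ∃ y ∈ filledJuliaSet (φ.map i), b ^ n ≤ ∏ j, ‖y - x j‖ := by
  set F := filledJuliaSet (φ.map i)
  have hφ' : 2 ≤ (φ.map i).natDegree := by rwa [natDegree_map]
  have hcpos := dynamicalCapacity_pos hφ'
  have hinf := infinite_preimage_filledJuliaSet i hφ
  rcases Nat.eq_zero_or_pos n with rfl | hn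
  · obtain ⟨z, hz⟩ := hinf.nonempty
    exact ⟨i z, hz, by simp⟩
  obtain ⟨δ, hδ, hsep⟩ := exists_forall_le_norm_sub (hinf.image i.injective.injOn) n
  by_contra! hcon
  have key : ∀ k : ℕ, δ ≤ dynamicalCapacity (φ.map i) *
      (b / dynamicalCapacity (φ.map i)) ^ (φ.natDegree ^ k) := by
    intro k
    -- The target `w` depends on `k`, but `δ` depends only on `n`.
    obtain ⟨_, ⟨w, hw, rfl⟩, hwδ⟩ := hsep fun j => (fun y => (φ.map i).eval y)^[k] (x j)
    set G : L[X] := φ.comp^[k] X - Polynomial.C w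
    have hGd : G.natDegree = φ.natDegree ^ k := by
      rw [natDegree_sub_C, natDegree_iterate_comp, natDegree_X, mul_one]
    have hpos : 0 < φ.natDegree ^ k := pow_pos (by lia) _
    have hmapit : (φ.comp^[k] X).map i = (φ.map i).comp^[k] X := by
      refine (Function.Semiconj.iterate_right (f := Polynomial.map i) (ga := φ.comp)
        (gb := (φ.map i).comp) (fun p => ?_) k X).trans (by rw [map_X])
      exact map_comp i φ p
    have hlead : i G.leadingCoeff = ((φ.map i).comp^[k] X).leadingCoeff := by
      rw [← hmapit, leadingCoeff_map, leadingCoeff_sub_of_degree_lt]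
      refine degree_C_le.trans_lt ?_
      rw [← natDegree_pos_iff_degree_pos, natDegree_iterate_comp, natDegree_X, mul_one]
      exact hpos
    have hfac : ∀ u : C, (fun y => (φ.map i).eval y)^[k] u - i w
        = i G.leadingCoeff * (G.roots.map fun z => u - i z).prod := by
      intro u
      have h1 : (G.map i).eval u = (fun y => (φ.map i).eval y)^[k] u - i w := by
        rw [Polynomial.map_sub, hmapit, eval_sub, map_C, eval_C, iterate_comp_eval, eval_X]
      rw [← h1]
      conv_lhs => rw [(IsAlgClosed.splits G).eq_prod_roots]
      rw [Polynomial.map_mul, eval_mul, map_C, eval_C, Polynomial.map_multiset_prod,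
        eval_multiset_prod, Multiset.map_map, Multiset.map_map]
      simp
    have hroot : ∀ z ∈ G.roots, ∏ j, ‖x j - i z‖ ≤ b ^ n := by
      intro z hz
      have hz' : (fun y => φ.eval y)^[k] z = w := by
        have := isRoot_of_mem_roots hz
        rwa [IsRoot, eval_sub, eval_C, sub_eq_zero, iterate_comp_eval, eval_X] at this
      have hzF : i z ∈ F := by
        rw [← eval_iterate_mem_filledJuliaSet k, ← map_iterate_eval, hz']
        exact hw
      simp_rw [norm_sub_rev (x _)]
      exact (hcon _ hzF).le
    have hup : ∏ j, ‖(fun y => (φ.map i).eval y)^[k] (x j) - i w‖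
        ≤ ‖i G.leadingCoeff‖ ^ n * (b ^ n) ^ (φ.natDegree ^ k) := by
      simp_rw [hfac, norm_mul]
      rw [Finset.prod_mul_distrib, Finset.prod_const, Finset.card_univ, Fintype.card_fin]
      refine mul_le_mul_of_nonneg_left ?_ (by positivity)
      have h2 : ∏ j, ‖(G.roots.map fun z => x j - i z).prod‖
          = (G.roots.map fun z => ∏ j, ‖x j - i z‖).prod := by
        rw [Multiset.prod_map_prod]
        refine Finset.prod_congr rfl fun j _ => ?_
        rw [← normHom_apply, map_multiset_prod, Multiset.map_map]
        rfl
      have hcard : G.roots.card = φ.natDegree ^ k := by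
        rw [← hGd, (IsAlgClosed.splits G).natDegree_eq_card_roots]
      rw [h2, ← hcard, ← Multiset.card_map (fun z => ∏ j, ‖x j - i z‖), ← Multiset.prod_replicate,
        Multiset.card_map, ← Multiset.map_const']
      exact Multiset.prod_map_le_prod_map₀ _ _
        (fun z _ => Finset.prod_nonneg fun _ _ => norm_nonneg _) hroot
    have hlow : δ ^ n ≤ ∏ j, ‖(fun y => (φ.map i).eval y)^[k] (x j) - i w‖ := by
      have := Finset.prod_le_prod (s := (Finset.univ : Finset (Fin n)))
        (fun _ _ => hδ.le) fun j _ => hwδ j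
      simpa using this
    have h3 := hlow.trans hup
    rw [← pow_mul, mul_comm n, pow_mul, ← mul_pow] at h3
    have h4 := (pow_le_pow_iff_left₀ hδ.le (by positivity) hn.ne').1 h3
    refine h4.trans (le_of_eq ?_)
    have h5 := norm_leadingCoeff_iterate_comp_mul hφ' k
    rw [natDegree_map, ← hlead] at h5
    rw [div_pow, ← mul_div_assoc, eq_div_iff (by positivity), mul_right_comm, h5]
  have hlt : b / dynamicalCapacity (φ.map i) < 1 := (div_lt_one hcpos).2 hbc
  have hlim := ((tendsto_pow_atTop_nhds_zero_of_lt_one (by positivity) hlt).comp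
    (tendsto_pow_atTop_atTop_of_one_lt (show 1 < φ.natDegree by lia))).const_mul
      (dynamicalCapacity (φ.map i))
  rw [mul_zero] at hlim
  exact absurd (ge_of_tendsto' hlim key) (not_le.2 hδ)

/-- Greedy choice, as for Leja points: the new point multiplies the determinant by its product of
distances to the earlier ones. -/
theorem exists_le_norm_det_vandermonde (hφ : 2 ≤ φ.natDegree) {b : ℝ} (hb : 0 < b)
    (hbc : b < dynamicalCapacity (φ.map i)) (n : ℕ) :
    ∃ x : Fin n → C, (∀ j, x j ∈ filledJuliaSet (φ.map i)) ∧
      b ^ (∑ j : Fin n, (j : ℕ)) ≤ ‖(Matrix.vandermonde x).det‖ := by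
  induction n with
  | zero => exact ⟨Fin.elim0, fun j => j.elim0, by simp⟩
  | succ n ih =>
    obtain ⟨x, hx, hxb⟩ := ih
    obtain ⟨y, hy, hyb⟩ := exists_mem_filledJuliaSet_le_prod i hφ hb hbc x
    refine ⟨Fin.cons y x, fun j => ?_, ?_⟩
    · refine Fin.cases ?_ (fun j => ?_) j
      · simpa using hy
      · simpa using hx j
    · have h1 : (Matrix.vandermonde (Fin.cons y x : Fin (n + 1) → C)).det
          = (∏ j, (x j - y)) * (Matrix.vandermonde x).det := by
        rw [Matrix.det_vandermonde, Matrix.det_vandermonde, Fin.prod_univ_succ]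
        simp [Fin.prod_Ioi_succ]
      rw [h1, norm_mul, norm_prod, Fin.sum_univ_castSucc, pow_add, mul_comm]
      simp_rw [norm_sub_rev _ y]
      simp only [Fin.val_castSucc, Fin.val_last]
      gcongr

theorem tendsto_nthDiameter_filledJuliaSet (hφ : 2 ≤ φ.natDegree) :
    Tendsto (nthDiameter (filledJuliaSet (φ.map i))) atTop
      (𝓝 (dynamicalCapacity (φ.map i))) := by
  have hφ' : 2 ≤ (φ.map i).natDegree := by rwa [natDegree_map]
  set c := dynamicalCapacity (φ.map i)
  have hc : 0 < c := dynamicalCapacity_pos hφ'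
  obtain ⟨A, hA0, hA⟩ := exists_prod_offDiag_rpow_le hφ'
  have hup : ∀ n : ℕ, 2 ≤ n → ∀ x : Fin n → filledJuliaSet (φ.map i),
      ∏ p ∈ (Finset.univ : Finset (Fin n)).offDiag,
        dist (x p.1 : C) (x p.2) ^ (1 / ((n : ℝ) * ((n : ℝ) - 1)))
      ≤ c * Real.exp (A * ((Real.log n + 1) / ((n : ℝ) - 1))) := by
    intro n hn x
    have := hA n hn fun j => (x j : C)
    simp_rw [canonicalLocalHeight_eq_zero hφ' (x _).2] at this
    simpa [dist_eq_norm] using this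
  have hlim : Tendsto (fun n : ℕ => c * Real.exp (A * ((Real.log n + 1) / ((n : ℝ) - 1))))
      atTop (𝓝 c) := by
    have := ((Real.continuous_exp.tendsto _).comp
      (tendsto_log_add_one_div_sub_one.const_mul A)).const_mul c
    simpa using this
  refine tendsto_of_tendsto_of_tendsto_of_le_of_le' tendsto_const_nhds hlim ?_ ?_
  · filter_upwards [eventually_ge_atTop 2] with n hn
    have hn' : (2 : ℝ) ≤ n := by exact_mod_cast hn
    refine le_of_forall_lt_imp_le_of_dense fun b hbc => ?_
    rcases le_or_gt b 0 with hb | hb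
    · exact hb.trans (Real.iSup_nonneg fun x => Finset.prod_nonneg fun _ _ => by positivity)
    obtain ⟨x, hx, hxb⟩ := exists_le_norm_det_vandermonde i hφ hb hbc n
    refine le_ciSup_of_le ⟨_, Set.forall_mem_range.2 (hup n hn)⟩ (fun j => ⟨x j, hx j⟩) ?_
    simp only [dist_eq_norm]
    have hn1 : 0 < (n : ℝ) * ((n : ℝ) - 1) := by nlinarith
    rw [Real.finsetProd_rpow _ _ fun _ _ => norm_nonneg _, prod_offDiag_norm_sub_eq, one_div,
      Real.le_rpow_inv_iff_of_pos hb.le (by positivity) hn1]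
    have h4 : (∑ j : Fin n, (j : ℕ)) * 2 = n * (n - 1) := by
      rw [Fin.sum_univ_eq_sum_range (fun j => j) n, Finset.sum_range_id_mul_two]
    have h5 : ((n * (n - 1) : ℕ) : ℝ) = n * ((n : ℝ) - 1) := by
      rw [Nat.cast_mul, Nat.cast_sub (by lia), Nat.cast_one]
    rw [← h5, Real.rpow_natCast, ← h4, pow_mul]
    gcongr
  · filter_upwards [eventually_ge_atTop 2] with n hn
    refine Real.iSup_le (hup n hn) (by positivity)

theorem transfiniteDiameter_filledJuliaSet (hφ : 2 ≤ φ.natDegree) :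
    transfiniteDiameter (filledJuliaSet (φ.map i)) = dynamicalCapacity (φ.map i) :=
  (tendsto_nthDiameter_filledJuliaSet i hφ).limUnder_eq

end TransfiniteDiameter

/-! ### Mean pairwise distance of a finite set -/

section PairwiseMean

variable {C : Type*} [NormedField C]

open Classical in
theorem pairwiseMean_eq_rpow (T : Finset C) :
    pairwiseMean T = (∏ p ∈ T.offDiag, ‖p.1 - p.2‖) ^ (1 / ((T.card : ℝ) * ((T.card : ℝ) - 1))) :=
  Real.finsetProd_rpow _ _ (fun _ _ => norm_nonneg _) _

theorem pairwiseMean_pos (T : Finset C) : 0 < pairwiseMean T :=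
  Finset.prod_pos fun _ hp =>
    Real.rpow_pos_of_pos (norm_pos_iff.2 (sub_ne_zero.2 (Finset.mem_offDiag.1 hp).2.2)) _

theorem exists_pairwiseMean_le {φ : C[X]} (hφ : 2 ≤ φ.natDegree) :
    ∃ A : ℝ, 0 ≤ A ∧ ∀ T : Finset C, 2 ≤ T.card →
      Real.log (pairwiseMean T) ≤ Real.log (dynamicalCapacity φ) +
        (A * ((Real.log T.card + 1) / ((T.card : ℝ) - 1)) +
          2 * ((∑ z ∈ T, canonicalLocalHeight φ z) / T.card)) := by
  classical
  obtain ⟨A, hA0, hA⟩ := exists_prod_offDiag_rpow_le hφ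
  refine ⟨A, hA0, fun T hT => ?_⟩
  have h1 := hA T.card hT fun j => (T.equivFin.symm j : C)
  have h2 : ∑ j, canonicalLocalHeight φ (T.equivFin.symm j : C)
      = ∑ z ∈ T, canonicalLocalHeight φ z := by
    rw [Equiv.sum_comp T.equivFin.symm (fun z : T => canonicalLocalHeight φ (z : C)),
      Finset.sum_coe_sort T (canonicalLocalHeight φ)]
  have h3 : ∏ p ∈ (Finset.univ : Finset (Fin T.card)).offDiag,
      ‖(T.equivFin.symm p.1 : C) - T.equivFin.symm p.2‖ ^
        (1 / ((T.card : ℝ) * ((T.card : ℝ) - 1))) = pairwiseMean T := by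
    refine Finset.prod_bij (fun p _ => ((T.equivFin.symm p.1 : C), (T.equivFin.symm p.2 : C)))
      ?_ ?_ ?_ fun _ _ => rfl
    · intro p hp
      rw [Finset.mem_offDiag] at hp ⊢
      refine ⟨Subtype.prop _, Subtype.prop _, fun h => hp.2.2 ?_⟩
      exact T.equivFin.symm.injective (Subtype.ext h)
    · intro p _ q _ h
      rw [Prod.mk.injEq] at h
      exact Prod.ext (T.equivFin.symm.injective (Subtype.ext h.1))
        (T.equivFin.symm.injective (Subtype.ext h.2))
    · intro q hq
      rw [Finset.mem_offDiag] at hq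
      refine ⟨(T.equivFin ⟨q.1, hq.1⟩, T.equivFin ⟨q.2, hq.2.1⟩), ?_, by simp⟩
      rw [Finset.mem_offDiag]
      refine ⟨Finset.mem_univ _, Finset.mem_univ _, fun h => hq.2.2 ?_⟩
      simpa using h
  rw [h2, h3] at h1
  have hc := dynamicalCapacity_pos hφ
  have h4 := Real.log_le_log (pairwiseMean_pos T) h1
  rwa [Real.log_mul hc.ne' (Real.exp_pos _).ne', Real.log_exp] at h4

end PairwiseMean

/-! ### Good reduction -/

section GoodReduction

variable {C : Type*} [NormedField C] [IsUltrametricDist C]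

/-- Integral coefficients preserve the unit ball; outside it the unit leading coefficient makes the
top term strictly dominant. -/
theorem posLog_norm_eval_of_norm_coeff_le_one {f : C[X]} (hf : 1 ≤ f.natDegree)
    (hcoeff : ∀ j, ‖f.coeff j‖ ≤ 1) (hlead : ‖f.leadingCoeff‖ = 1) (x : C) :
    Real.posLog ‖f.eval x‖ = f.natDegree * Real.posLog ‖x‖ := by
  have hbound : ∀ p : C[X], (∀ j, ‖p.coeff j‖ ≤ 1) → ∀ k, p.natDegree ≤ k →
      ‖p.eval x‖ ≤ max 1 ‖x‖ ^ k := by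
    intro p hp k hk
    rw [eval_eq_sum_range]
    refine IsUltrametricDist.norm_sum_le_of_forall_le_of_nonneg (by positivity) fun j hj => ?_
    rw [norm_mul, norm_pow]
    calc ‖p.coeff j‖ * ‖x‖ ^ j ≤ 1 * max 1 ‖x‖ ^ j := by
          gcongr
          · exact hp j
          · exact le_max_right _ _
      _ ≤ max 1 ‖x‖ ^ k := by
          rw [one_mul]
          exact pow_le_pow_right₀ (le_max_left _ _) ((Finset.mem_range_succ_iff.1 hj).trans hk)
  rcases le_or_gt ‖x‖ 1 with hx | hx
  · have h1 := hbound f hcoeff _ le_rfl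
    rw [max_eq_left hx, one_pow] at h1
    rw [(Real.posLog_eq_zero_iff _).2 (by rwa [abs_norm]),
      (Real.posLog_eq_zero_iff _).2 (by rwa [abs_norm]), mul_zero]
  · have h1 := hbound f.eraseLead (fun j => by
      rw [eraseLead_coeff]
      split_ifs
      · simp
      · exact hcoeff j) _ (eraseLead_natDegree_le f)
    rw [max_eq_right hx.le] at h1
    have h2 : ‖f.leadingCoeff * x ^ f.natDegree‖ = ‖x‖ ^ f.natDegree := by
      rw [norm_mul, hlead, one_mul, norm_pow]
    have h3 : ‖f.eraseLead.eval x‖ < ‖f.leadingCoeff * x ^ f.natDegree‖ := by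
      rw [h2]
      exact h1.trans_lt (pow_lt_pow_right₀ hx (by lia))
    have h4 : f.eval x = f.eraseLead.eval x + f.leadingCoeff * x ^ f.natDegree := by
      have h4 := congrArg (eval x) (eraseLead_add_C_mul_X_pow f)
      simp only [eval_add, eval_mul, eval_C, eval_pow, eval_X] at h4
      exact h4.symm
    have h5 : ‖f.eval x‖ = ‖x‖ ^ f.natDegree := by
      rw [h4, IsUltrametricDist.norm_add_eq_max_of_norm_ne_norm h3.ne, max_eq_right h3.le, h2]
    rw [h5, Real.posLog_eq_log_max_one (by positivity), Real.posLog_eq_log_max_one (by positivity),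
      max_eq_right (one_le_pow₀ hx.le), max_eq_right hx.le, Real.log_pow]

theorem canonicalLocalHeight_of_norm_coeff_le_one {f : C[X]} (hf : 1 ≤ f.natDegree)
    (hcoeff : ∀ j, ‖f.coeff j‖ ≤ 1) (hlead : ‖f.leadingCoeff‖ = 1) (x : C) :
    canonicalLocalHeight f x = Real.posLog ‖x‖ := by
  have h1 : ∀ n : ℕ, Real.posLog ‖(fun y => f.eval y)^[n] x‖ / (f.natDegree : ℝ) ^ n
      = Real.posLog ‖x‖ := by
    intro n
    have hd : (0 : ℝ) < f.natDegree := by exact_mod_cast hf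
    rw [div_eq_iff (by positivity)]
    induction n with
    | zero => simp
    | succ n ih =>
      rw [Function.iterate_succ_apply', posLog_norm_eval_of_norm_coeff_le_one hf hcoeff hlead, ih]
      ring
  rw [canonicalLocalHeight]
  simp_rw [h1]
  exact tendsto_const_nhds.limUnder_eq

theorem posLog_norm_sub_le (x y : C) :
    Real.posLog ‖x - y‖ ≤ Real.posLog ‖x‖ + Real.posLog ‖y‖ := by
  have h : ‖x - y‖ ≤ max ‖x‖ ‖y‖ := by
    rw [sub_eq_add_neg, ← norm_neg y]
    exact IsUltrametricDist.norm_add_le_max x (-y)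
  refine (Real.posLog_le_posLog (norm_nonneg _) h).trans ?_
  have hx : 0 ≤ Real.posLog ‖x‖ := Real.posLog_nonneg
  have hy : 0 ≤ Real.posLog ‖y‖ := Real.posLog_nonneg
  rcases max_choice ‖x‖ ‖y‖ with h | h <;> rw [h] <;> linarith

end GoodReduction

/-! ### Galois-stable sets -/

section GaloisStable

variable {K : Type*} [Field K]

theorem sum_offDiag_add {α : Type*} [DecidableEq α] (S : Finset α) (f : α → ℝ) :
    ∑ p ∈ S.offDiag, (f p.1 + f p.2) = 2 * ((S.card : ℝ) - 1) * ∑ z ∈ S, f z := by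
  have h1 : ∑ p ∈ S ×ˢ S, (f p.1 + f p.2) = 2 * S.card * ∑ z ∈ S, f z := by
    rw [Finset.sum_product]
    simp only [Finset.sum_add_distrib, Finset.sum_const, nsmul_eq_mul, ← Finset.mul_sum]
    ring
  rw [← Finset.diag_union_offDiag, Finset.sum_union (Finset.disjoint_diag_offDiag _),
    Finset.sum_diag, Finset.sum_add_distrib] at h1
  linarith

theorem galoisHull_eq_of_stable {S : Set (AlgebraicClosure K)}
    (hS : ∀ σ : AlgebraicClosure K ≃ₐ[K] AlgebraicClosure K, ∀ z ∈ S, σ z ∈ S) :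
    galoisHull S = S := by
  ext z
  constructor
  · rintro ⟨σ, t, ht, rfl⟩
    exact hS σ t ht
  · exact fun hz => ⟨AlgEquiv.refl, z, hz, rfl⟩

theorem rootSet_minpoly_subset {S : Set (AlgebraicClosure K)}
    (hS : ∀ σ : AlgebraicClosure K ≃ₐ[K] AlgebraicClosure K, ∀ z ∈ S, σ z ∈ S)
    {x : AlgebraicClosure K} (hx : x ∈ S) :
    (minpoly K x).rootSet (AlgebraicClosure K) ⊆ S := by
  intro r hr
  obtain ⟨σ, hσ⟩ := minpoly.exists_algEquiv_of_root (Algebra.IsAlgebraic.isAlgebraic x)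
    (mem_rootSet.1 hr).2
  have : r = σ.symm x := by rw [← hσ, AlgEquiv.symm_apply_apply]
  exact this ▸ hS σ.symm x hx

/-- `S` contains all conjugates of `x`, and separability makes them as numerous as the degree. -/
theorem natDegree_minpoly_le_card {S : Finset (AlgebraicClosure K)}
    (hS : ∀ σ : AlgebraicClosure K ≃ₐ[K] AlgebraicClosure K, ∀ z ∈ S, σ z ∈ S)
    {x : AlgebraicClosure K} (hx : x ∈ S) (hsep : IsSeparable K x) :
    (minpoly K x).natDegree ≤ S.card := by
  have h1 := card_rootSet_eq_natDegree (K := AlgebraicClosure K) hsep (IsAlgClosed.splits _)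
  rw [← h1, ← Nat.card_eq_fintype_card, Nat.card_coe_set_eq, ← Set.ncard_coe_finset]
  exact Set.ncard_le_ncard (rootSet_minpoly_subset (K := K) (S := (S : Set (AlgebraicClosure K))) hS hx)
    S.finite_toSet

theorem mem_range_algebraMap_of_forall_algEquiv_eq {x : AlgebraicClosure K}
    (hsep : IsSeparable K x)
    (hfix : ∀ σ : AlgebraicClosure K ≃ₐ[K] AlgebraicClosure K, σ x = x) :
    x ∈ (algebraMap K (AlgebraicClosure K)).range := by
  have h1 := natDegree_minpoly_le_card (S := {x})
    (fun σ z hz => by rw [Finset.mem_singleton] at hz ⊢; rw [hz, hfix])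
    (Finset.mem_singleton_self x) hsep
  rw [Finset.card_singleton] at h1
  exact minpoly.natDegree_eq_one_iff.1 (le_antisymm h1 (minpoly.natDegree_pos hsep.isIntegral))

/-- The product is separable, and automorphisms only permute its factors. It is the element to which
the product formula is applied. -/
theorem exists_algebraMap_eq_prod_offDiag {S : Finset (AlgebraicClosure K)}
    (hS : ∀ σ : AlgebraicClosure K ≃ₐ[K] AlgebraicClosure K, ∀ z ∈ S, σ z ∈ S)
    (hsep : ∀ z ∈ S, IsSeparable K z) :
    ∃ δ : K, δ ≠ 0 ∧ algebraMap K (AlgebraicClosure K) δ = ∏ p ∈ S.offDiag, (p.1 - p.2) := by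
  have h1 : ∏ p ∈ S.offDiag, (p.1 - p.2) ∈ (algebraMap K (AlgebraicClosure K)).range := by
    refine mem_range_algebraMap_of_forall_algEquiv_eq ?_ fun σ => ?_
    · rw [← mem_separableClosure_iff]
      refine prod_mem fun p hp => sub_mem ?_ ?_ <;> rw [mem_separableClosure_iff]
      · exact hsep _ (Finset.mem_offDiag.1 hp).1
      · exact hsep _ (Finset.mem_offDiag.1 hp).2.1
    · rw [map_prod]
      refine Finset.prod_nbij' (fun p => (σ p.1, σ p.2)) (fun p => (σ.symm p.1, σ.symm p.2))
        ?_ ?_ (by simp) (by simp) (by simp)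
      all_goals
        intro p hp
        rw [Finset.mem_offDiag] at hp ⊢
        refine ⟨hS _ _ hp.1, hS _ _ hp.2.1, fun h => hp.2.2 ?_⟩
        simpa using h
  obtain ⟨δ, hδ⟩ := h1
  refine ⟨δ, ?_, hδ⟩
  rintro rfl
  rw [map_zero] at hδ
  exact (Finset.prod_ne_zero_iff.2
    fun p hp => sub_ne_zero.2 (Finset.mem_offDiag.1 hp).2.2) hδ.symm

end GaloisStable

theorem sum_le_finsum_of_nonneg {M : Type*} {f : M → ℝ} (hf : f.support.Finite)
    (h0 : ∀ v, 0 ≤ f v) (T : Finset M) : ∑ v ∈ T, f v ≤ ∑ᶠ v, f v := by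
  classical
  rw [finsum_eq_sum_of_support_subset f (s := T ∪ hf.toFinset) (by simp)]
  exact Finset.sum_le_sum_of_subset_of_nonneg Finset.subset_union_left fun v _ _ => h0 v

theorem finsum_mem_div_ncard_le {α : Type*} {s : Set α} (hs : s.Finite) (hne : s.Nonempty)
    {f : α → ℝ} {b : ℝ} (hf : ∀ z ∈ s, f z ≤ b) : (∑ᶠ z ∈ s, f z) / (s.ncard : ℝ) ≤ b := by
  have hpos : (0 : ℝ) < s.ncard := by exact_mod_cast (Set.ncard_pos hs).2 hne
  rw [div_le_iff₀ hpos, finsum_mem_eq_finite_toFinset_sum _ hs, Set.ncard_eq_toFinset_card _ hs,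
    mul_comm, ← nsmul_eq_mul]
  exact Finset.sum_le_card_nsmul _ _ _ fun z hz => hf z (hs.mem_toFinset.1 hz)

/-! ### Heights over a field with a product formula -/

namespace ProductFormulaField

variable {K : Type*} [Field K] {M : Type*} (P : ProductFormulaField K M)

theorem norm_algebraMap_Cv (v : M) (x : K) : ‖algebraMap K (P.Cv v) x‖ = P.abv v x := by
  have : algebraMap K (P.Cv v) x = ((WithAbs.toAbs _ (algebraMap (P.CompletionAt v)
      (AlgebraicClosure (P.CompletionAt v))
      ((WithAbs.toAbs (P.abv v) x : WithAbs (P.abv v)) : P.CompletionAt v)) :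
      WithAbs (P.closureAbv v)) : P.Cv v) := rfl
  rw [this, UniformSpace.Completion.norm_coe]
  exact (P.closureAbv_algebraMap v _).trans (UniformSpace.Completion.norm_coe _)

/-- A normed field is ultrametric as soon as natural numbers have norm at most one, which can be
checked in `K`. -/
theorem isUltrametricDist_Cv {v : M} (hv : IsNonarchimedean (P.abv v)) :
    IsUltrametricDist (P.Cv v) := by
  refine IsUltrametricDist.isUltrametricDist_of_forall_norm_natCast_le_one fun n => ?_
  rw [← map_natCast (algebraMap K (P.Cv v)), norm_algebraMap_Cv]
  exact hv.apply_natCast_le_one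

/-- A place is good for `f` if it is ultrametric and all nonzero coefficients of `f` are units. -/
def IsGood (f : K[X]) (v : M) : Prop :=
  IsNonarchimedean (P.abv v) ∧ ∀ j ∈ f.support, P.abv v (f.coeff j) = 1

theorem finite_not_isGood (f : K[X]) : {v | ¬ P.IsGood f v}.Finite := by
  refine (P.finite_archimedean.union (f.support.finite_toSet.biUnion fun j hj =>
    P.finite_ne_one (f.coeff j) (mem_support_iff.1 hj))).subset fun v hv => ?_
  simp only [IsGood, Set.mem_ofPred_eq, not_and_or, not_forall] at hv
  rcases hv with h | ⟨j, hj, h⟩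
  · exact Or.inl h
  · exact Or.inr (Set.mem_biUnion hj h)

variable {P}

theorem IsGood.norm_coeff_le_one {f : K[X]} {v : M} (h : P.IsGood f v) (j : ℕ) :
    ‖(P.polyAt f v).coeff j‖ ≤ 1 := by
  rw [coeff_map, norm_algebraMap_Cv]
  by_cases hj : j ∈ f.support
  · exact (h.2 j hj).le
  · rw [notMem_support_iff.1 hj, map_zero]
    exact zero_le_one

theorem IsGood.norm_leadingCoeff {f : K[X]} {v : M} (h : P.IsGood f v) (hf : f ≠ 0) :
    ‖(P.polyAt f v).leadingCoeff‖ = 1 := by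
  rw [leadingCoeff_map, norm_algebraMap_Cv]
  exact h.2 _ (natDegree_mem_support_of_nonzero hf)

theorem IsGood.posLog_norm_eval {f : K[X]} {v : M} (h : P.IsGood f v) (hf : 1 ≤ f.natDegree)
    (x : P.Cv v) :
    Real.posLog ‖(P.polyAt f v).eval x‖ = f.natDegree * Real.posLog ‖x‖ := by
  have := P.isUltrametricDist_Cv h.1
  have hf0 : f ≠ 0 := by rintro rfl; simp at hf
  rw [posLog_norm_eval_of_norm_coeff_le_one (by rwa [natDegree_map]) h.norm_coeff_le_one
    (h.norm_leadingCoeff hf0), natDegree_map]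

theorem IsGood.canonicalLocalHeight_eq {f : K[X]} {v : M} (h : P.IsGood f v)
    (hf : 1 ≤ f.natDegree) (x : P.Cv v) :
    canonicalLocalHeight (P.polyAt f v) x = Real.posLog ‖x‖ := by
  have := P.isUltrametricDist_Cv h.1
  have hf0 : f ≠ 0 := by rintro rfl; simp at hf
  exact canonicalLocalHeight_of_norm_coeff_le_one (by rwa [natDegree_map]) h.norm_coeff_le_one
    (h.norm_leadingCoeff hf0) x

variable (e : P.Embeddings)

/-- At a good place for the minimal polynomial `m` of `z`, `0 = log⁺ |m(z)| = deg m · log⁺ |z|`. -/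
theorem finite_posLog_ne_zero (z : AlgebraicClosure K) :
    {v | Real.posLog ‖e v z‖ ≠ 0}.Finite := by
  refine (P.finite_not_isGood (minpoly K z)).subset fun v hv hgood => hv ?_
  have hint : IsIntegral K z := Algebra.IsIntegral.isIntegral z
  have hdeg := minpoly.natDegree_pos hint
  have h1 := hgood.posLog_norm_eval hdeg (e v z)
  rw [eval_map_algebraMap, aeval_algHom_apply, minpoly.aeval, map_zero, norm_zero,
    Real.posLog_zero] at h1
  have hd : ((minpoly K z).natDegree : ℝ) ≠ 0 := by exact_mod_cast hdeg.ne'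
  exact (mul_eq_zero.1 h1.symm).resolve_left hd

theorem embedding_iterate_aeval (φ : K[X]) (v : M) (n : ℕ) (z : AlgebraicClosure K) :
    e v ((fun x => aeval x φ)^[n] z) = (fun y => (P.polyAt φ v).eval y)^[n] (e v z) := by
  refine Function.Semiconj.iterate_right (f := e v) (fun y => ?_) n z
  rw [eval_map_algebraMap, aeval_algHom_apply]

theorem polyAt_eq_map (φ : K[X]) (v : M) :
    P.polyAt φ v
      = (φ.map (algebraMap K (AlgebraicClosure K))).map (e v : AlgebraicClosure K →+* P.Cv v) := by
  rw [Polynomial.map_map, AlgHom.comp_algebraMap]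

/-- The sum of the canonical local heights of a point. -/
noncomputable def canonicalLocalHeightSum (φ : K[X]) (z : AlgebraicClosure K) : ℝ :=
  ∑ᶠ v : M, P.weight v * canonicalLocalHeight (P.polyAt φ v) (e v z)

variable {φ : K[X]}

theorem two_le_natDegree_polyAt (hφ : 2 ≤ φ.natDegree) (v : M) :
    2 ≤ (P.polyAt φ v).natDegree := by rwa [natDegree_map]

theorem weight_mul_canonicalLocalHeight_nonneg (hφ : 2 ≤ φ.natDegree) (v : M) (x : P.Cv v) :
    0 ≤ P.weight v * canonicalLocalHeight (P.polyAt φ v) x :=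
  mul_nonneg (P.weight_pos v).le (canonicalLocalHeight_nonneg (two_le_natDegree_polyAt hφ v) x)

theorem finite_support_posLog (z : AlgebraicClosure K) :
    (Function.support fun v => P.weight v * Real.posLog ‖e v z‖).Finite :=
  (finite_posLog_ne_zero e z).subset fun _ hv h => hv (by simp only [h, mul_zero])

theorem finite_support_canonicalLocalHeight (hφ : 2 ≤ φ.natDegree) (z : AlgebraicClosure K) :
    (Function.support fun v =>
      P.weight v * canonicalLocalHeight (P.polyAt φ v) (e v z)).Finite := by
  refine ((P.finite_not_isGood φ).union (finite_posLog_ne_zero e z)).subset fun v hv => ?_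
  by_contra hcon
  rw [Set.mem_union, not_or] at hcon
  simp only [Set.mem_ofPred_eq, not_not] at hcon
  exact hv (by simp only [hcon.1.canonicalLocalHeight_eq (by lia), hcon.2, mul_zero])

/-- At a good place with `|z| ≤ 1` the whole orbit stays in the unit ball. One finite set of places
thus serves all `n`, and limit and sum can be exchanged. -/
theorem tendsto_localHeightSum_iterate (hφ : 2 ≤ φ.natDegree) (z : AlgebraicClosure K) :
    Tendsto (fun n : ℕ => P.localHeightSum e ((fun x => aeval x φ)^[n] z) /
      (φ.natDegree : ℝ) ^ n) atTop (𝓝 (canonicalLocalHeightSum e φ z)) := by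
  classical
  set T := ((P.finite_not_isGood φ).union (finite_posLog_ne_zero e z)).toFinset
  have hT : ∀ v ∉ T, P.IsGood φ v ∧ Real.posLog ‖e v z‖ = 0 := by
    intro v hv
    simpa [T, not_or] using hv
  have h1 : ∀ n : ℕ, P.localHeightSum e ((fun x => aeval x φ)^[n] z) / (φ.natDegree : ℝ) ^ n
      = ∑ v ∈ T, P.weight v * (Real.posLog ‖(fun y => (P.polyAt φ v).eval y)^[n] (e v z)‖ /
        ((P.polyAt φ v).natDegree : ℝ) ^ n) := by
    intro n
    rw [localHeightSum, finsum_eq_sum_of_support_subset (s := T), Finset.sum_div]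
    · refine Finset.sum_congr rfl fun v _ => ?_
      rw [embedding_iterate_aeval, natDegree_map, mul_div_assoc]
    · intro v hv
      by_contra hvT
      obtain ⟨hg, h0⟩ := hT v hvT
      refine hv ?_
      have : ∀ m : ℕ, Real.posLog ‖(fun y => (P.polyAt φ v).eval y)^[m] (e v z)‖ = 0 := by
        intro m
        induction m with
        | zero => simpa using h0
        | succ m ih =>
          rw [Function.iterate_succ_apply', hg.posLog_norm_eval (by lia), ih, mul_zero]
      simp only [embedding_iterate_aeval, this, mul_zero]
  have h2 : canonicalLocalHeightSum e φ z
      = ∑ v ∈ T, P.weight v * canonicalLocalHeight (P.polyAt φ v) (e v z) := by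
    refine finsum_eq_sum_of_support_subset _ fun v hv => ?_
    by_contra hvT
    obtain ⟨hg, h0⟩ := hT v hvT
    exact hv (by simp only [hg.canonicalLocalHeight_eq (by lia), h0, mul_zero])
  simp_rw [h1, h2]
  exact tendsto_finsetSum _ fun v _ =>
    (tendsto_canonicalLocalHeight (two_le_natDegree_polyAt hφ v) _).const_mul _

theorem canonicalHeight_eq (hφ : 2 ≤ φ.natDegree) {S : Finset (AlgebraicClosure K)}
    (hS : ∀ σ : AlgebraicClosure K ≃ₐ[K] AlgebraicClosure K, ∀ z ∈ S, σ z ∈ S) :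
    P.canonicalHeight e φ (S : Set (AlgebraicClosure K))
      = (∑ z ∈ S, canonicalLocalHeightSum e φ z) / S.card := by
  rw [canonicalHeight, galoisHull_eq_of_stable hS]
  simp_rw [finsum_mem_coe_finset, Set.ncard_coe_finset, div_right_comm _ (S.card : ℝ),
    Finset.sum_div _ _ ((φ.natDegree : ℝ) ^ _)]
  exact ((tendsto_finsetSum S fun z _ =>
    tendsto_localHeightSum_iterate e hφ z).div_const _).limUnder_eq

theorem canonicalLocalHeightSum_nonneg (hφ : 2 ≤ φ.natDegree) (z : AlgebraicClosure K) :
    0 ≤ canonicalLocalHeightSum e φ z :=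
  finsum_nonneg fun v => weight_mul_canonicalLocalHeight_nonneg hφ v _

/-- The two local heights agree at good places and differ by a bounded amount at the finitely many
others. -/
theorem exists_localHeightSum_le (hφ : 2 ≤ φ.natDegree) :
    ∃ b : ℝ, ∀ z, P.localHeightSum e z ≤ canonicalLocalHeightSum e φ z + b := by
  classical
  choose b hb0 hb using fun v : M =>
    exists_canonicalLocalHeight_bound (P.polyAt φ v) (two_le_natDegree_polyAt hφ v)
  set B := (P.finite_not_isGood φ).toFinset
  refine ⟨∑ v ∈ B, P.weight v * b v, fun z => ?_⟩
  set T := B ∪ (finite_support_posLog e z).toFinset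
  have hBT : B ⊆ T := Finset.subset_union_left
  have h1 : P.localHeightSum e z = ∑ v ∈ T, P.weight v * Real.posLog ‖e v z‖ :=
    finsum_eq_sum_of_support_subset _ (by simp [T])
  have h2 : ∑ v ∈ T, P.weight v * canonicalLocalHeight (P.polyAt φ v) (e v z)
      ≤ canonicalLocalHeightSum e φ z :=
    sum_le_finsum_of_nonneg (finite_support_canonicalLocalHeight e hφ z)
      (fun v => weight_mul_canonicalLocalHeight_nonneg hφ v _) T
  have h3 : ∀ v ∈ T, P.weight v * Real.posLog ‖e v z‖
      ≤ P.weight v * canonicalLocalHeight (P.polyAt φ v) (e v z)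
        + if v ∈ B then P.weight v * b v else 0 := by
    intro v _
    split_ifs with hv
    · rw [← mul_add]
      refine mul_le_mul_of_nonneg_left ?_ (P.weight_pos v).le
      have := (abs_le.1 (hb v (e v z)).2).2
      linarith
    · have hg : P.IsGood φ v := by simpa [B] using hv
      rw [hg.canonicalLocalHeight_eq (by lia), add_zero]
  have h4 := Finset.sum_le_sum h3
  rw [Finset.sum_add_distrib, Finset.sum_ite_mem, Finset.inter_eq_right.2 hBT] at h4
  linarith

/-! ### Consequences of the product formula and of the Northcott property -/

theorem sum_weight_mul_log_abv {δ : K} (hδ : δ ≠ 0) {T : Finset M}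
    (hT : ∀ v ∉ T, P.abv v δ = 1) : ∑ v ∈ T, P.weight v * Real.log (P.abv v δ) = 0 := by
  have hpos : ∀ v, 0 < P.abv v δ := fun v => (P.abv v).pos hδ
  have h1 := P.product_formula δ hδ
  rw [finprod_eq_prod_of_mulSupport_subset (s := T)] at h1
  · have h2 := congrArg Real.log h1
    rw [Real.log_prod fun v _ => (Real.rpow_pos_of_pos (hpos v) _).ne', Real.log_one] at h2
    rw [← h2]
    exact Finset.sum_congr rfl fun v _ => (Real.log_rpow (hpos v) _).symm
  · intro v hv
    by_contra hvT
    exact hv (by simp only [hT v hvT, Real.one_rpow])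

theorem average_canonicalLocalHeight_le (hφ : 2 ≤ φ.natDegree) {S : Finset (AlgebraicClosure K)}
    (hS : ∀ σ : AlgebraicClosure K ≃ₐ[K] AlgebraicClosure K, ∀ z ∈ S, σ z ∈ S) (v : M) :
    P.weight v * ((∑ z ∈ P.imageAt e v S, canonicalLocalHeight (P.polyAt φ v) z) /
      (P.imageAt e v S).card) ≤ P.canonicalHeight e φ (S : Set (AlgebraicClosure K)) := by
  rw [canonicalHeight_eq e hφ hS, imageAt, Finset.sum_map, Finset.card_map, ← mul_div_assoc,
    Finset.mul_sum]
  refine div_le_div_of_nonneg_right (Finset.sum_le_sum fun z _ => ?_) (Nat.cast_nonneg _)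
  have := sum_le_finsum_of_nonneg (finite_support_canonicalLocalHeight e hφ z)
    (fun v => weight_mul_canonicalLocalHeight_nonneg hφ v _) {v}
  rwa [Finset.sum_singleton] at this

theorem log_pairwiseMean_imageAt {S : Finset (AlgebraicClosure K)} {δ : K}
    (hδ : algebraMap K (AlgebraicClosure K) δ = ∏ p ∈ S.offDiag, (p.1 - p.2)) (v : M) :
    Real.log (pairwiseMean (P.imageAt e v S))
      = Real.log (P.abv v δ) / ((S.card : ℝ) * ((S.card : ℝ) - 1)) := by
  classical
  have h1 : ∏ p ∈ (P.imageAt e v S).offDiag, ‖p.1 - p.2‖ = P.abv v δ := by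
    rw [← norm_algebraMap_Cv, ← (e v).commutes, hδ, map_prod, norm_prod]
    symm
    refine Finset.prod_bij (fun p _ => (e v p.1, e v p.2)) ?_ ?_ ?_ ?_
    · intro p hp
      rw [Finset.mem_offDiag] at hp ⊢
      exact ⟨Finset.mem_map_of_mem _ hp.1, Finset.mem_map_of_mem _ hp.2.1,
        fun h => hp.2.2 ((e v).injective h)⟩
    · intro p _ q _ h
      rw [Prod.mk.injEq] at h
      exact Prod.ext ((e v).injective h.1) ((e v).injective h.2)
    · intro q hq
      obtain ⟨h1, h2, h3⟩ := Finset.mem_offDiag.1 hq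
      obtain ⟨x, hx, hx'⟩ := Finset.mem_map.1 h1
      obtain ⟨y, hy, hy'⟩ := Finset.mem_map.1 h2
      refine ⟨(x, y), Finset.mem_offDiag.2 ⟨hx, hy, ?_⟩, Prod.ext hx' hy'⟩
      intro hxy
      obtain rfl : x = y := hxy
      exact h3 (hx'.symm.trans hy')
    · intro p _
      rw [map_sub]
  have hpos : 0 < ∏ p ∈ (P.imageAt e v S).offDiag, ‖p.1 - p.2‖ :=
    Finset.prod_pos fun p hp => norm_pos_iff.2 (sub_ne_zero.2 (Finset.mem_offDiag.1 hp).2.2)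
  rw [pairwiseMean_eq_rpow, Real.log_rpow hpos, h1, imageAt, Finset.card_map]
  ring

/-- By the ultrametric inequality `log |x - y| ≤ log⁺ |x| + log⁺ |y|`, and at a good place `log⁺` is
the canonical local height. Each point occurs in `2(#S - 1)` ordered pairs. -/
theorem IsGood.log_abv_le {v : M} (hv : P.IsGood φ v) (hφ : 2 ≤ φ.natDegree)
    {S : Finset (AlgebraicClosure K)} {δ : K}
    (hδ : algebraMap K (AlgebraicClosure K) δ = ∏ p ∈ S.offDiag, (p.1 - p.2)) :
    Real.log (P.abv v δ)
      ≤ 2 * ((S.card : ℝ) - 1) * ∑ z ∈ S, canonicalLocalHeight (P.polyAt φ v) (e v z) := by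
  classical
  have := P.isUltrametricDist_Cv hv.1
  rw [← sum_offDiag_add, ← norm_algebraMap_Cv, ← (e v).commutes, hδ, map_prod, norm_prod,
    Real.log_prod]
  · refine Finset.sum_le_sum fun p _ => ?_
    rw [hv.canonicalLocalHeight_eq (by lia), hv.canonicalLocalHeight_eq (by lia), map_sub]
    exact (le_max_right 0 _).trans (posLog_norm_sub_le _ _)
  · intro p hp
    exact norm_ne_zero_iff.2 ((_root_.map_ne_zero _).2 (sub_ne_zero.2 (Finset.mem_offDiag.1 hp).2.2))

/-- The logarithms of the product of differences sum to zero, and the places outside `B` contribute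
at most `2(N - 1)` times the sum of the canonical heights; division by `N(N - 1)` leaves twice their
average. -/
theorem neg_two_mul_canonicalHeight_le (hφ : 2 ≤ φ.natDegree)
    {S : Finset (AlgebraicClosure K)}
    (hS : ∀ σ : AlgebraicClosure K ≃ₐ[K] AlgebraicClosure K, ∀ z ∈ S, σ z ∈ S)
    (hsep : ∀ z ∈ S, IsSeparable K z) (hcard : 2 ≤ S.card) {B : Finset M}
    (hB : ∀ v ∉ B, P.IsGood φ v) :
    -(2 * P.canonicalHeight e φ (S : Set (AlgebraicClosure K)))
      ≤ ∑ v ∈ B, P.weight v * Real.log (pairwiseMean (P.imageAt e v S)) := by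
  classical
  obtain ⟨δ, hδ0, hδ⟩ := exists_algebraMap_eq_prod_offDiag hS hsep
  set T := B ∪ (P.finite_ne_one δ hδ0).toFinset
  have hT := sum_weight_mul_log_abv (T := T) hδ0 fun v hv => by
    by_contra h
    exact hv (Finset.mem_union_right _ (by simpa using h))
  rw [← Finset.sum_sdiff (Finset.subset_union_left : B ⊆ T)] at hT
  have hN : (2 : ℝ) ≤ S.card := by exact_mod_cast hcard
  have hN1 : 0 < (S.card : ℝ) - 1 := by linarith
  have h1 : ∑ v ∈ T \ B, P.weight v * Real.log (P.abv v δ)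
      ≤ 2 * ((S.card : ℝ) - 1) * ∑ z ∈ S, canonicalLocalHeightSum e φ z := by
    calc ∑ v ∈ T \ B, P.weight v * Real.log (P.abv v δ)
        ≤ ∑ v ∈ T \ B, P.weight v * (2 * ((S.card : ℝ) - 1) *
            ∑ z ∈ S, canonicalLocalHeight (P.polyAt φ v) (e v z)) :=
          Finset.sum_le_sum fun v hv => mul_le_mul_of_nonneg_left
            ((hB v (Finset.mem_sdiff.1 hv).2).log_abv_le e hφ hδ) (P.weight_pos v).le
      _ = 2 * ((S.card : ℝ) - 1) * ∑ z ∈ S, ∑ v ∈ T \ B,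
            P.weight v * canonicalLocalHeight (P.polyAt φ v) (e v z) := by
          rw [Finset.sum_comm, Finset.mul_sum]
          refine Finset.sum_congr rfl fun v _ => ?_
          rw [← Finset.mul_sum]
          ring
      _ ≤ _ := by
          gcongr with z _
          exact sum_le_finsum_of_nonneg (finite_support_canonicalLocalHeight e hφ z)
            (fun v => weight_mul_canonicalLocalHeight_nonneg hφ v _) _
  simp_rw [log_pairwiseMean_imageAt e hδ, ← mul_div_assoc]
  rw [← Finset.sum_div, le_div_iff₀ (by positivity), canonicalHeight_eq e hφ hS]
  have h2 : -(2 * ((∑ z ∈ S, canonicalLocalHeightSum e φ z) / S.card)) *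
      ((S.card : ℝ) * ((S.card : ℝ) - 1))
      = -(2 * ((S.card : ℝ) - 1) * ∑ z ∈ S, canonicalLocalHeightSum e φ z) := by
    field_simp
  rw [h2]
  linarith

theorem sum_weight_mul_log_dynamicalCapacity (hφ : 2 ≤ φ.natDegree) {B : Finset M}
    (hB : ∀ v ∉ B, P.IsGood φ v) :
    ∑ v ∈ B, P.weight v * Real.log (dynamicalCapacity (P.polyAt φ v)) = 0 := by
  have hφ0 : φ ≠ 0 := by rintro rfl; simp at hφ
  have h1 := sum_weight_mul_log_abv (leadingCoeff_ne_zero.2 hφ0) (T := B)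
    fun v hv => (hB v hv).2 _ (natDegree_mem_support_of_nonzero hφ0)
  simp_rw [log_dynamicalCapacity, natDegree_map, leadingCoeff_map, norm_algebraMap_Cv,
    mul_left_comm (P.weight _), ← Finset.mul_sum, h1, mul_zero]

theorem tendsto_card_of_northcott (hN : P.Northcott e) (hφ : 2 ≤ φ.natDegree)
    {S : ℕ → Finset (AlgebraicClosure K)} (hS : Function.Injective S)
    (hsep : ∀ n, ∀ z ∈ S n, IsSeparable K z)
    (hGal : ∀ n, ∀ σ : AlgebraicClosure K ≃ₐ[K] AlgebraicClosure K, ∀ z ∈ S n, σ z ∈ S n)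
    {H : ℝ} (hH : ∀ n, P.canonicalHeight e φ (S n : Set (AlgebraicClosure K)) ≤ H) :
    Tendsto (fun n => (S n).card) atTop atTop := by
  obtain ⟨b, hb⟩ := exists_localHeightSum_le (P := P) e hφ
  refine tendsto_atTop.2 fun N => ?_
  rw [← Nat.cofinite_eq_atTop, eventually_cofinite]
  -- In a set with fewer than `N` points, a single canonical height is at most the sum over the set,
  -- hence at most `N max(H, 0)`; `b` passes to the ordinary height. All such sets lie in one finite
  -- set, which has finitely many subsets.
  have hfin := hN N (N * max H 0 + b)
  refine Set.Finite.subset (Set.Finite.preimage hS.injOn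
    (Finset.finite_toSet hfin.toFinset.powerset)) fun n hn => ?_
  rw [Set.mem_ofPred_eq, not_le] at hn
  rw [Set.mem_preimage, Finset.mem_coe, Finset.mem_powerset]
  intro x hx
  rw [Set.Finite.mem_toFinset]
  refine ⟨(natDegree_minpoly_le_card (hGal n) hx (hsep n x hx)).trans hn.le, ?_⟩
  have hsub : galoisHull {x} ⊆ (S n : Set (AlgebraicClosure K)) := by
    rintro _ ⟨σ, t, rfl, rfl⟩
    exact hGal n σ _ hx
  refine finsum_mem_div_ncard_le ((S n).finite_toSet.subset hsub)
    ⟨x, AlgEquiv.refl, x, rfl, rfl⟩ fun z hz => (hb z).trans ?_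
  gcongr
  have hcard : (0 : ℝ) < (S n).card := by exact_mod_cast Finset.card_pos.2 ⟨x, hx⟩
  have h1 := hH n
  rw [canonicalHeight_eq e hφ (hGal n), div_le_iff₀ hcard] at h1
  calc canonicalLocalHeightSum e φ z ≤ ∑ z ∈ S n, canonicalLocalHeightSum e φ z :=
        Finset.single_le_sum (fun z _ => canonicalLocalHeightSum_nonneg e hφ z)
          (Finset.mem_coe.1 (hsub hz))
    _ ≤ (S n).card * max H 0 := by
        rw [mul_comm]
        exact h1.trans (by gcongr; exact le_max_left _ _)
    _ ≤ N * max H 0 := by gcongr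

end ProductFormulaField

/-! ### Pseudo-equidistribution -/

theorem theorem2 {K : Type*} [Field K] {M : Type*} (P : ProductFormulaField K M)
    (e : P.Embeddings) (hN : P.Northcott e)
    (φ : K[X]) (hφ : 2 ≤ φ.natDegree)
    (S : ℕ → Finset (AlgebraicClosure K)) (hS : Function.Injective S)
    (hsep : ∀ n, ∀ z ∈ S n, IsSeparable K z)
    (hGal : ∀ n, ∀ σ : AlgebraicClosure K ≃ₐ[K] AlgebraicClosure K, ∀ z ∈ S n, σ z ∈ S n)
    (hlim : Tendsto (fun n => P.canonicalHeight e φ (S n : Set (AlgebraicClosure K)))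
      atTop (𝓝 0))
    (v : M) :
    IsPseudoEquidistributed (filledJuliaSet (P.polyAt φ v))
      (canonicalLocalHeight (P.polyAt φ v)) (fun n => P.imageAt e v (S n)) := by
  classical
  have htaut : ∀ w : M, IsTaut (canonicalLocalHeight (P.polyAt φ w))
      (fun n => P.imageAt e w (S n)) := by
    intro w
    have h1 := hlim.const_mul (P.weight w)⁻¹
    rw [mul_zero] at h1
    refine squeeze_zero (fun n => div_nonneg (Finset.sum_nonneg fun z _ =>
      canonicalLocalHeight_nonneg (ProductFormulaField.two_le_natDegree_polyAt hφ w) z)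
      (Nat.cast_nonneg _)) (fun n => ?_) h1
    rw [le_inv_mul_iff₀ (P.weight_pos w)]
    exact ProductFormulaField.average_canonicalLocalHeight_le e hφ (hGal n) w
  obtain ⟨H, hH⟩ := hlim.bddAbove_range
  have hcard := ProductFormulaField.tendsto_card_of_northcott e hN hφ hS hsep hGal
    fun n => hH (Set.mem_range_self n)
  refine ⟨htaut v, by simpa [ProductFormulaField.imageAt] using hcard, ?_⟩
  -- The place `v` is added so that it appears in the finite sum even when it is good.
  set B : Finset M := insert v (P.finite_not_isGood φ).toFinset
  have hB : ∀ w ∉ B, P.IsGood φ w := by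
    intro w hw
    by_contra h
    exact hw (Finset.mem_insert_of_mem (by simpa using h))
  have hvB : v ∈ B := Finset.mem_insert_self _ _
  choose A hA0 hA using fun w : M =>
    exists_pairwiseMean_le (ProductFormulaField.two_le_natDegree_polyAt (P := P) hφ w)
  let u : M → ℕ → ℝ := fun w n => Real.log (dynamicalCapacity (P.polyAt φ w)) +
    (A w * ((Real.log (P.imageAt e w (S n)).card + 1) / (((P.imageAt e w (S n)).card : ℝ) - 1)) +
      2 * ((∑ z ∈ P.imageAt e w (S n), canonicalLocalHeight (P.polyAt φ w) z) /
        (P.imageAt e w (S n)).card))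
  have hu : ∀ w, Tendsto (u w) atTop (𝓝 (Real.log (dynamicalCapacity (P.polyAt φ w)))) := by
    intro w
    have hc : Tendsto (fun n => (P.imageAt e w (S n)).card) atTop atTop := by
      simpa [ProductFormulaField.imageAt] using hcard
    have := (((tendsto_log_add_one_div_sub_one.comp hc).const_mul (A w)).add
      ((htaut w).const_mul 2)).const_add (Real.log (dynamicalCapacity (P.polyAt φ w)))
    simpa using this
  have hlog : Tendsto (fun n => Real.log (pairwiseMean (P.imageAt e v (S n)))) atTop
      (𝓝 (Real.log (dynamicalCapacity (P.polyAt φ v)))) := by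
    -- The product formula inequality is solved for the term at `v`, with the upper bounds `u w` at
    -- the other places. The limit is `log c_v` because the weighted `log c_w` over `B` sum to zero.
    have hlow : Tendsto (fun n => (P.weight v)⁻¹ *
        (-(2 * P.canonicalHeight e φ (S n : Set (AlgebraicClosure K))) -
          ∑ w ∈ B.erase v, P.weight w * u w n)) atTop
        (𝓝 (Real.log (dynamicalCapacity (P.polyAt φ v)))) := by
      have h1 := (((hlim.const_mul 2).neg).sub (tendsto_finsetSum (B.erase v)
        fun w _ => (hu w).const_mul (P.weight w))).const_mul (P.weight v)⁻¹
      have h2 := ProductFormulaField.sum_weight_mul_log_dynamicalCapacity hφ hB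
      rw [← Finset.add_sum_erase B _ hvB] at h2
      have h3 : (P.weight v)⁻¹ * (-(2 * 0) - ∑ w ∈ B.erase v,
          P.weight w * Real.log (dynamicalCapacity (P.polyAt φ w)))
          = Real.log (dynamicalCapacity (P.polyAt φ v)) := by
        rw [inv_mul_eq_iff_eq_mul₀ (P.weight_pos v).ne']
        linarith
      rwa [h3] at h1
    refine tendsto_of_tendsto_of_tendsto_of_le_of_le' hlow (hu v) ?_ ?_
    · filter_upwards [hcard.eventually_ge_atTop 2] with n hn
      have h1 := ProductFormulaField.neg_two_mul_canonicalHeight_le e hφ (hGal n) (hsep n) hn hB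
      rw [← Finset.add_sum_erase B _ hvB] at h1
      rw [inv_mul_le_iff₀ (P.weight_pos v)]
      have h2 : ∑ w ∈ B.erase v, P.weight w * Real.log (pairwiseMean (P.imageAt e w (S n)))
          ≤ ∑ w ∈ B.erase v, P.weight w * u w n :=
        Finset.sum_le_sum fun w _ => mul_le_mul_of_nonneg_left
          (hA w _ (by rwa [ProductFormulaField.imageAt, Finset.card_map])) (P.weight_pos w).le
      linarith
    · filter_upwards [hcard.eventually_ge_atTop 2] with n hn
      exact hA v _ (by rwa [ProductFormulaField.imageAt, Finset.card_map])
  have hcap : transfiniteDiameter (filledJuliaSet (P.polyAt φ v))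
      = dynamicalCapacity (P.polyAt φ v) := by
    -- Factoring through `K̄` supplies the algebraically closed field needed for backward orbits.
    rw [ProductFormulaField.polyAt_eq_map e]
    exact transfiniteDiameter_filledJuliaSet _ (by rwa [natDegree_map])
  rw [hcap]
  have h1 := (Real.continuous_exp.tendsto _).comp hlog
  rw [Real.exp_log (dynamicalCapacity_pos
    (ProductFormulaField.two_le_natDegree_polyAt hφ v))] at h1
  exact h1.congr fun n => Real.exp_log (pairwiseMean_pos _)
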